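/- Let $T>0$, $\omega_0=2\pi/T$, $\alpha>\tfrac12$, and let $\mathcal G=(\mathbf Q,\tilde{\mathbf b}(t),\tilde{\mathbf c}(t))$ and $\mathcal H=(\mathbf Q,\mathbf b(t),\mathbf c(t))$ be two single-input/single-output linear time-periodic systems $\dot{\mathbf z}=\mathbf Q\mathbf z+\mathbf b(t)u$, $y=\mathbf c(t)^T\mathbf z$ sharing the matrix $\mathbf Q\in\mathbb R^{n\times n}$. The real vector functions $\tilde{\mathbf b},\tilde{\mathbf c},\mathbf b,\mathbf c$ have components in $\mathsf{Lip}(\alpha)$: they are continuous and $T$-periodic, with $|f(t_1)-f(t_2)|\le M|t_1-t_2|^\alpha$ on $[0,T]$ for some finite $M$. Assume that the eigenvalues $\lambda_1,\dots,\lambda_n$ of $\mathbf Q$ are simple, lie in the open left half-plane and satisfy $|\mathrm{Im}\,\lambda_j|<\omega_0$. The impulse response of $\mathcal G$ is $g(t,\tau)=\tilde{\mathbf c}(t)^Te^{\mathbf Q(t-\tau)}\tilde{\mathbf b}(\tau)$ for $\tau\le t$ and $0$ for $t<\tau$; $h$ is that of $\mathcal H$. Put $$\langle\mathcal G,\mathcal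 H\rangle_{\mathsf H_2}=\frac1T\int_0^T\!\int_0^\infty\overline{g(t,t-r)}\,h(t,t-r)\,dr\,dt,\qquad \|\mathcal G\|_{\mathsf H_2}^2=\frac1T\int_0^T\!\int_0^\infty|g(t,t-r)|^2\,dr\,dt .$$ With Fourier coefficients $\mathbf x_k=\frac1T\int_0^Te^{-\mathrm ik\omega_0t}\mathbf x(t)\,dt$, put $\hat g_k(s)=\sum_{\ell\in\mathbb Z}\tilde{\mathbf c}_{k-\ell}^T[(s+\mathrm i\ell\omega_0)\mathbf I-\mathbf Q]^{-1}\tilde{\mathbf b}_\ell$, define $\hat h_k$ likewise from $\mathbf c,\mathbf b$, and let $\lambda_j^{(\ell)}=\lambda_j-\mathrm i\ell\omega_0$. For a function $f$ write $\overline f(s)=\overline{f(\overline s)}$. Then the following hold. (i) For every $k\in\mathbb Z$, $\hat g_k$ is meromorphic on $\mathbb C$ and for $\mathrm{Re}\,s>0$ equals the absolutely convergent Laplace transform of the subsystem $g_k(r)=\frac1T\int_0^Te^{-\mathrm ik\omega_0t}g(t,t-r)\,dt$; likewise for $\hat h_k$. The integrals defining $\langle\mathcal G,\mathcal H\rangle_{\mathsf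 H_2}$ and $\|\mathcal G\|_{\mathsf H_2}^2$ converge absolutely. (ii) If the points $\lambda_j^{(\ell)}$ ($\ell\in\mathbb Z$, $1\le j\le n$) are pairwise distinct, then $$\langle\mathcal G,\mathcal H\rangle_{\mathsf H_2}=\sum_{k\in\mathbb Z}\sum_{\ell\in\mathbb Z}\sum_{j=1}^n\overline{\hat g_k}(-\lambda_j^{(\ell)})\,\mathsf{res}[\hat h_k,\lambda_j^{(\ell)}],\qquad \|\mathcal G\|_{\mathsf H_2}^2=\sum_{k\in\mathbb Z}\sum_{\ell\in\mathbb Z}\sum_{j=1}^n\overline{\hat g_k}(-\lambda_j^{(\ell)})\,\mathsf{res}[\hat g_k,\lambda_j^{(\ell)}],$$ both series being absolutely convergent over all $(k,\ell,j)$. (iii) Without the distinctness condition in (ii), the same formulas hold, with absolute convergence, when the inner double sum is taken over the set $\{\lambda_j^{(\ell)}:\ell\in\mathbb Z,\ 1\le j\le n\}$, each point being counted once. -/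

import Mathlib

open scoped ComplexConjugate Matrix

noncomputable section

namespace LTP

/-- `Lip(α)` for period `T`: continuous `T`-periodic functions with
`|f t₁ - f t₂| ≤ M |t₁ - t₂| ^ α` on `[0, T]` for some finite `M`. -/
structure IsLip (T α : ℝ) (f : ℝ → ℝ) : Prop where
  continuous : Continuous f
  periodic : Function.Periodic f T
  holder : ∃ M : ℝ, ∀ t₁ ∈ Set.Icc 0 T, ∀ t₂ ∈ Set.Icc 0 T, |f t₁ - f t₂| ≤ M * |t₁ - t₂| ^ α

/-- The data `(Q, b, c)` of a single-input/single-output system in Floquet form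
`z' = Q z + b(t) u`, `y = c(t)ᵀ z`, with real state space of dimension `n`. -/
structure System (n : ℕ) where
  Q : Matrix (Fin n) (Fin n) ℝ
  b : ℝ → Fin n → ℝ
  c : ℝ → Fin n → ℝ

/-- The fundamental frequency `ω₀ = 2π / T`. -/
def freq (T : ℝ) : ℝ := 2 * Real.pi / T

/-- `k`-th Fourier coefficient `(1/T) ∫₀ᵀ e^{-i k ω₀ t} f(t) dt` of a `T`-periodic function. -/
def fourierCoef (T : ℝ) (f : ℝ → ℂ) (k : ℤ) : ℂ :=
  (1 / (T : ℂ)) * ∫ t in (0 : ℝ)..T, Complex.exp (-(Complex.I * k * freq T * t)) * f t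

/-- Componentwise Fourier coefficients of a real vector-valued function, so that
`x(t) = ∑ₖ xₖ e^{i k ω₀ t}`. -/
def vecFourierCoef {n : ℕ} (T : ℝ) (x : ℝ → Fin n → ℝ) (k : ℤ) : Fin n → ℂ :=
  fun i => fourierCoef T (fun t => (x t i : ℂ)) k

variable {n : ℕ}

/-- The impulse response `g(t, τ) = c(t)ᵀ e^{Q (t - τ)} b(τ)` for `τ ≤ t`, and `0` for `t < τ`. -/
def System.impulse (G : System n) (t τ : ℝ) : ℝ :=
  if τ ≤ t then G.c t ⬝ᵥ (NormedSpace.exp ((t - τ) • G.Q) *ᵥ G.b τ) else 0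

/-- The integrand `conj g(t, t - r) * h(t, t - r)` of the `H₂` inner product, as a function of
`(t, r)`. -/
def h2Integrand (G H : System n) (x : ℝ × ℝ) : ℂ :=
  conj (G.impulse x.1 (x.1 - x.2) : ℂ) * (H.impulse x.1 (x.1 - x.2) : ℂ)

/-- Absolute convergence of the integral defining the `H₂` inner product. -/
def H2Integrable (T : ℝ) (G H : System n) : Prop :=
  MeasureTheory.IntegrableOn (h2Integrand G H) (Set.Icc 0 T ×ˢ Set.Ioi 0)

/-- The periodic `H₂` inner product
`(1/T) ∫₀ᵀ ∫₀^∞ conj g(t, t - r) h(t, t - r) dr dt`. -/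
def h2Inner (T : ℝ) (G H : System n) : ℂ :=
  (1 / (T : ℂ)) * ∫ t in (0 : ℝ)..T, ∫ r in Set.Ioi (0 : ℝ), h2Integrand G H (t, r)

/-- The periodic `H₂` norm. -/
def h2Norm (T : ℝ) (G : System n) : ℝ :=
  Real.sqrt (1 / T * ∫ t in (0 : ℝ)..T, ∫ r in Set.Ioi (0 : ℝ), |G.impulse t (t - r)| ^ 2)

/-- The `k`-th subsystem in the time domain,
`g_k(r) = (1/T) ∫₀ᵀ e^{-i k ω₀ t} g(t, t - r) dt`. -/
def System.subsystem (T : ℝ) (G : System n) (k : ℤ) (r : ℝ) : ℂ :=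
  fourierCoef T (fun t => (G.impulse t (t - r) : ℂ)) k

/-- The `k`-th subsystem in the frequency domain,
`ĝ_k(s) = ∑_ℓ c_{k-ℓ}ᵀ [(s + i ℓ ω₀) I - Q]⁻¹ b_ℓ`. -/
def System.transfer (T : ℝ) (G : System n) (k : ℤ) (s : ℂ) : ℂ :=
  ∑' l : ℤ, vecFourierCoef T G.c (k - l) ⬝ᵥ
    (((s + Complex.I * l * freq T) • (1 : Matrix (Fin n) (Fin n) ℂ)
      - G.Q.map Complex.ofReal)⁻¹ *ᵥ vecFourierCoef T G.b l)

/-- `F` is a meromorphic function on the plane which, on the open right half-plane, is the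
(absolutely convergent) Laplace transform of `f`. -/
def IsMeromorphicLaplace (f : ℝ → ℂ) (F : ℂ → ℂ) : Prop :=
  Meromorphic F ∧ ∀ s : ℂ, 0 < s.re →
    MeasureTheory.IntegrableOn (fun r : ℝ => Complex.exp (-(s * r)) * f r) (Set.Ioi 0) ∧
    ∫ r in Set.Ioi (0 : ℝ), Complex.exp (-(s * r)) * f r = F s

/-- The residue of `f` at an isolated singularity `p`: the value of `(2πi)⁻¹ ∮ f` over
all sufficiently small circles around `p`. -/
def residue (f : ℂ → ℂ) (p : ℂ) : ℂ :=
  Filter.limUnder (nhdsWithin (0 : ℝ) (Set.Ioi 0)) fun ε : ℝ =>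
    (2 * Real.pi * Complex.I)⁻¹ * ∮ z in C(p, ε), f z

/-- The points `λ_j^{(ℓ)} = λ_j - i ℓ ω₀`. -/
def pole (T : ℝ) (lam : Fin n → ℂ) (l : ℤ) (j : Fin n) : ℂ :=
  lam j - Complex.I * l * freq T

/-- The set of the points `λ_j^{(ℓ)}`. -/
def poleSet (T : ℝ) (lam : Fin n → ℂ) : Set ℂ :=
  {p | ∃ (l : ℤ) (j : Fin n), p = pole T lam l j}

/-- The function with conjugated coefficients, `f̄(s) = conj (f (conj s))`. -/
def conjFun (f : ℂ → ℂ) (s : ℂ) : ℂ := conj (f (conj s))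

/-- The pole-residue term `ĝ̄_k(-p) res[ĥ_k, p]`. -/
def poleResidueTerm (T : ℝ) (G H : System n) (k : ℤ) (p : ℂ) : ℂ :=
  conjFun (G.transfer T k) (-p) * residue (H.transfer T k) p

end LTP

end

/-! Everything follows from one absolutely convergent expansion. By Bernstein's theorem
(`IsLip.summable_fourierCoef`) the Fourier series of the entries of `b` and `c` converge absolutely,
and since the eigenvalues are simple, `e^{Qr} = ∑ e^{λ_j r} P_j` with spectral projections `P_j`.
Multiplying out (`System.hasSum_modes`), `g(t, t - r)` is a sum of modes `e^{i k ω₀ t} e^{p r}`, `p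
= λ_j^{(ℓ)}`, with the summable coefficients `System.modeCoef`. All `p` satisfy `Re p ≤ -δ` for one
`δ > 0`, so termwise operations are legitimate.

Fixing `k` and taking Laplace transforms gives `∑ a / (s - p)`, which is `ĝ_k`
(`System.transfer_eq_tsum`). The points `p` do not accumulate, so this is meromorphic with at most
simple poles, and its residue at a point is the sum of the coefficients whose `p` equals that point
(`System.residue_transfer`).

In the inner product, orthogonality in `t` leaves only pairs of modes with equal `k`, and
integration in `r` yields `1 / (-conj p - p')`. Summing over the modes of `G` first produces `conj
(ĝ_k (-conj p'))` times a coefficient of `H` (`hasSum_pairing`). This first factor depends only on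
the point `p'`, so grouping the modes of `H` by that point turns the coefficients into residues
(`hasSum_poleResidueTerm`). -/

noncomputable section

namespace LTP

/-! ### Fourier coefficients of periodic functions -/

section FourierSeries

variable {T : ℝ} {f : ℝ → ℂ}

theorem exp_freq_add_period (hT : 0 < T) (k : ℤ) (t : ℝ) :
    Complex.exp (-(Complex.I * k * freq T * ((t + T : ℝ) : ℂ))) =
      Complex.exp (-(Complex.I * k * freq T * t)) := by
  have hT' : (T : ℂ) ≠ 0 := by exact_mod_cast hT.ne'
  have : -(Complex.I * k * freq T * ((t + T : ℝ) : ℂ)) =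
      -(Complex.I * k * freq T * t) - (k : ℤ) * (2 * Real.pi * Complex.I) := by
    simp only [freq]
    push_cast
    field_simp
    ring
  rw [this, Complex.exp_periodic.sub_int_mul_eq]

theorem fourierCoef_comp_add_right (hT : 0 < T) (hper : Function.Periodic f T) (h : ℝ) (k : ℤ) :
    fourierCoef T (fun t => f (t + h)) k =
      Complex.exp (Complex.I * k * freq T * h) * fourierCoef T f k := by
  set ψ : ℝ → ℂ := fun t => Complex.exp (-(Complex.I * k * freq T * t)) * f t with hψ
  have hψper : Function.Periodic ψ T := fun t => by
    simp only [hψ, hper t, exp_freq_add_period hT]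
  have h1 : ∀ t : ℝ, Complex.exp (-(Complex.I * k * freq T * t)) * f (t + h) =
      Complex.exp (Complex.I * k * freq T * h) * ψ (t + h) := fun t => by
    simp only [hψ]
    rw [← mul_assoc, ← Complex.exp_add]
    congr 2
    push_cast
    ring
  unfold fourierCoef
  simp only [h1]
  rw [intervalIntegral.integral_const_mul, intervalIntegral.integral_comp_add_right ψ h,
    zero_add, add_comm T h, hψper.intervalIntegral_add_eq h 0, zero_add]
  ring

theorem fourierCoef_sub {g : ℝ → ℂ} (hf : Continuous f) (hg : Continuous g) (k : ℤ) :
    fourierCoef T (fun t => f t - g t) k = fourierCoef T f k - fourierCoef T g k := by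
  unfold fourierCoef
  simp only [mul_sub]
  rw [intervalIntegral.integral_sub, mul_sub]
  all_goals exact Continuous.intervalIntegrable (by fun_prop) _ _

theorem fourierCoeffOn_eq_fourierCoef (hT : 0 < T) (f : ℝ → ℂ) (k : ℤ) :
    fourierCoeffOn hT f k = fourierCoef T f k := by
  rw [fourierCoeffOn_eq_integral, fourierCoef]
  simp only [fourier_coe_apply, sub_zero, Complex.real_smul, smul_eq_mul]
  push_cast
  congr 1
  refine intervalIntegral.integral_congr fun t _ => ?_
  simp only [freq]
  congr 2
  push_cast
  field_simp

theorem hasSum_sq_fourierCoef (hT : 0 < T) (hf : Continuous f) :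
    HasSum (fun k => ‖fourierCoef T f k‖ ^ 2) (T⁻¹ * ∫ t in (0 : ℝ)..T, ‖f t‖ ^ 2) := by
  have hL2 : MeasureTheory.MemLp f 2 (MeasureTheory.volume.restrict (Set.Ioc 0 T)) := by
    obtain ⟨C, hC⟩ := isCompact_Icc.exists_bound_of_continuousOn (hf.continuousOn (s := Set.Icc 0 T))
    refine MeasureTheory.MemLp.of_bound hf.aestronglyMeasurable C ?_
    filter_upwards [MeasureTheory.ae_restrict_mem measurableSet_Ioc] with t ht
    exact hC t (Set.Ioc_subset_Icc_self ht)
  simpa [fourierCoeffOn_eq_fourierCoef] using hasSum_sq_fourierCoeffOn hT hL2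

/-- Pointwise convergence of an absolutely convergent Fourier series. -/
theorem hasSum_fourierCoef (hT : 0 < T) (hf : Continuous f) (hper : Function.Periodic f T)
    (hs : Summable (fourierCoef T f)) (t : ℝ) :
    HasSum (fun k : ℤ => fourierCoef T f k * Complex.exp (Complex.I * k * freq T * t)) (f t) := by
  have := Fact.mk hT
  let F : C(AddCircle T, ℂ) := ⟨hper.lift, continuous_quot_lift _ hf⟩
  have hF : ∀ s : ℝ, F (s : AddCircle T) = f s := fun s => hper.lift_coe s
  have hcoef : fourierCoeff F = fourierCoef T f := by
    funext k
    rw [fourierCoeff_eq_intervalIntegral _ _ 0, fourierCoef]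
    simp only [fourier_coe_apply, zero_add, Complex.real_smul, smul_eq_mul, hF]
    push_cast
    congr 1
    refine intervalIntegral.integral_congr fun t _ => ?_
    simp only [freq]
    congr 2
    push_cast
    field_simp
  have h := has_pointwise_sum_fourier_series_of_summable (f := F) (by rwa [hcoef]) (t : AddCircle T)
  rw [hcoef, hF] at h
  convert h using 2 with k
  rw [fourier_coe_apply, smul_eq_mul, freq]
  congr 2
  push_cast
  field_simp

end FourierSeries

/-! ### Absolute convergence for Hölder exponent above 1/2 -/

section Bernstein

variable {T α : ℝ} {f : ℝ → ℝ}

/-- The Hölder bound is available on `[0, T]` only. When `t + h` passes `T`, the increment is split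
there and periodicity moves the second piece back, which costs a factor 2. -/
theorem IsLip.exists_shift_bound (hT : 0 < T) (hα : 0 < α) (hf : IsLip T α f) :
    ∃ M : ℝ, 0 ≤ M ∧ ∀ h ∈ Set.Icc 0 T, ∀ t ∈ Set.Icc 0 T, |f (t + h) - f t| ≤ M * h ^ α := by
  obtain ⟨M, hM⟩ := hf.holder
  have hM' : ∀ t₁ ∈ Set.Icc 0 T, ∀ t₂ ∈ Set.Icc 0 T, ∀ h, |t₁ - t₂| ≤ h →
      |f t₁ - f t₂| ≤ |M| * h ^ α := fun t₁ h₁ t₂ h₂ h hh =>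
    (hM t₁ h₁ t₂ h₂).trans <| mul_le_mul (le_abs_self M)
      (Real.rpow_le_rpow (abs_nonneg _) hh hα.le) (by positivity) (abs_nonneg M)
  refine ⟨2 * |M|, by positivity, fun h hh t ht => ?_⟩
  have hpos : 0 ≤ |M| * h ^ α := mul_nonneg (abs_nonneg M) (Real.rpow_nonneg hh.1 _)
  rcases le_total (t + h) T with hle | hle
  · have := hM' (t + h) ⟨by linarith [ht.1, hh.1], hle⟩ t ht h
      (by rw [add_sub_cancel_left, abs_of_nonneg hh.1])
    linarith
  · have h1 := hM' T ⟨hT.le, le_rfl⟩ t ht h (by rw [abs_of_nonneg] <;> linarith [ht.2])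
    have h2 := hM' (t + h - T) ⟨by linarith, by linarith [ht.2, hh.2]⟩ 0 ⟨le_rfl, hT.le⟩ h
      (by rw [abs_of_nonneg] <;> linarith [ht.2])
    have h3 : f (t + h - T) = f (t + h) := hf.periodic.sub_eq _
    have h4 : f 0 = f T := by simpa using (hf.periodic 0).symm
    rw [h3, h4] at h2
    calc |f (t + h) - f t| ≤ |f (t + h) - f T| + |f T - f t| := abs_sub_le _ _ _
      _ ≤ 2 * |M| * h ^ α := by linarith

/-- Parseval's identity for the difference of a `Lip(α)` function and a translate of it. -/
theorem IsLip.exists_hasSum_shift (hT : 0 < T) (hα : 0 < α) (hf : IsLip T α f) :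
    ∃ M : ℝ, 0 ≤ M ∧ ∀ h ∈ Set.Icc 0 T, ∃ S ≤ M * h ^ (2 * α), HasSum (fun k : ℤ =>
      ‖Complex.exp (Complex.I * k * freq T * h) - 1‖ ^ 2 *
        ‖fourierCoef T (fun t => (f t : ℂ)) k‖ ^ 2) S := by
  obtain ⟨M, hM0, hM⟩ := hf.exists_shift_bound hT hα
  refine ⟨M ^ 2, by positivity, fun h hh => ?_⟩
  have hfc : Continuous fun t => (f t : ℂ) := Complex.continuous_ofReal.comp hf.continuous
  have hfp : Function.Periodic (fun t => (f t : ℂ)) T := fun t => by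
    simp only [hf.periodic t]
  have hfh : Continuous fun t => (f (t + h) : ℂ) := hfc.comp (by fun_prop)
  have hsum := hasSum_sq_fourierCoef hT (hfh.sub hfc)
  refine ⟨_, ?_, hsum.congr_fun fun k => ?_⟩
  · have hb : ∀ t ∈ Set.Icc 0 T, ‖(f (t + h) : ℂ) - f t‖ ^ 2 ≤ M ^ 2 * h ^ (2 * α) := fun t ht => by
      have e : M ^ 2 * h ^ (2 * α) = (M * h ^ α) ^ 2 := by
        rw [mul_pow, mul_comm 2 α, Real.rpow_mul hh.1]
        norm_num
      rw [e, ← Complex.ofReal_sub, Complex.norm_real, Real.norm_eq_abs]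
      exact pow_le_pow_left₀ (abs_nonneg _) (hM h hh t ht) 2
    have hI : ∫ t in (0 : ℝ)..T, ‖(f (t + h) : ℂ) - f t‖ ^ 2 ≤
        ∫ t in (0 : ℝ)..T, M ^ 2 * h ^ (2 * α) :=
      intervalIntegral.integral_mono_on hT.le (Continuous.intervalIntegrable (by fun_prop) _ _)
        (Continuous.intervalIntegrable (by fun_prop) _ _) hb
    rw [intervalIntegral.integral_const, sub_zero, smul_eq_mul] at hI
    calc T⁻¹ * ∫ t in (0 : ℝ)..T, ‖(f (t + h) : ℂ) - f t‖ ^ 2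
        ≤ T⁻¹ * (T * (M ^ 2 * h ^ (2 * α))) := by gcongr
      _ = _ := by field_simp
  · change _ = ‖fourierCoef T (fun t => (f (t + h) : ℂ) - f t) k‖ ^ 2
    rw [fourierCoef_sub hfh hfc, fourierCoef_comp_add_right hT hfp, ← mul_pow, ← norm_mul,
      sub_mul, one_mul]

/-- The quantity is `2 - 2 cos θ`, and `cos θ ≤ -1/2` within `π / 3` of `±π`. This keeps the
Parseval weights of a shift away from zero on a whole dyadic block of frequencies. -/
theorem three_le_norm_exp_sub_one_sq {θ : ℝ} (h₁ : 2 * Real.pi / 3 ≤ |θ|)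
    (h₂ : |θ| ≤ 4 * Real.pi / 3) : 3 ≤ ‖Complex.exp (θ * Complex.I) - 1‖ ^ 2 := by
  have hcos : Real.cos θ ≤ -(1 / 2) := by
    rw [← Real.cos_abs, ← neg_le_neg_iff, neg_neg, ← Real.cos_sub_pi, ← Real.cos_pi_div_three,
      ← Real.cos_abs (|θ| - Real.pi)]
    have := Real.pi_pos
    refine Real.cos_le_cos_of_nonneg_of_le_pi (abs_nonneg _) (by linarith) ?_
    rw [abs_le]
    constructor <;> linarith
  rw [← Complex.normSq_eq_norm_sq, Complex.normSq_apply, Complex.exp_ofReal_mul_I]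
  simp [Complex.cos_ofReal_re, Complex.sin_ofReal_re]
  nlinarith [Real.sin_sq_add_cos_sq θ]

/-- **Bernstein's theorem**: the Fourier series of a `Lip(α)` function with `α > 1/2`
converges absolutely. -/
theorem IsLip.summable_fourierCoef (hT : 0 < T) (hα : 1 / 2 < α) (hf : IsLip T α f) :
    Summable (fourierCoef T fun t => (f t : ℂ)) := by
  obtain ⟨M, hM0, hM⟩ := hf.exists_hasSum_shift hT (by linarith)
  obtain ⟨a, ha⟩ : ∃ a : ℤ → ℝ, a = fun k => ‖fourierCoef T (fun t => (f t : ℂ)) k‖ := ⟨_, rfl⟩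
  have ha0 : ∀ k, 0 ≤ a k := fun k => by rw [ha]; exact norm_nonneg _
  simp only [← congrFun ha] at hM
  -- The weight `2^{γ j}` on the `j`-th shift must keep the Parseval sums summable over `j` (`γ <
  -- 2α`) and make `∑ |l|^{-γ}` finite (`γ > 1`).
  obtain ⟨γ, hγ1, hγ2⟩ : ∃ γ : ℝ, 1 < γ ∧ γ < 2 * α := exists_between (by linarith)
  -- For `2^j ≤ |l| ≤ 2^{j+1}` the angle `l ω₀ h_j = (2π/3) l 2^{-j}` has modulus in `[2π/3, 4π/3]`.
  let h : ℕ → ℝ := fun j => T / 3 * (2 : ℝ) ^ (-(j : ℝ))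
  have hh : ∀ j, h j ∈ Set.Icc 0 T := fun j => by
    refine ⟨by positivity, ?_⟩
    have : (2 : ℝ) ^ (-(j : ℝ)) ≤ 1 := Real.rpow_le_one_of_one_le_of_nonpos (by norm_num) (by simp)
    simp only [h]
    nlinarith
  choose S hS hsum using fun j => hM (h j) (hh j)
  let w : ℕ × ℤ → ℝ := fun x => (2 : ℝ) ^ (γ * x.1) *
    (‖Complex.exp (Complex.I * x.2 * freq T * h x.1) - 1‖ ^ 2 * a x.2 ^ 2)
  have hw0 : 0 ≤ w := fun x => by positivity
  have hwsum : Summable w := by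
    rw [summable_prod_of_nonneg hw0]
    refine ⟨fun j => (hsum j).summable.mul_left ((2 : ℝ) ^ (γ * j)), ?_⟩
    have hgeom : Summable fun j : ℕ => (M * (T / 3) ^ (2 * α)) * ((2 : ℝ) ^ (γ - 2 * α)) ^ j :=
      (summable_geometric_of_lt_one (by positivity)
        (Real.rpow_lt_one_of_one_lt_of_neg (by norm_num) (by linarith))).mul_left _
    refine Summable.of_nonneg_of_le (fun j => tsum_nonneg fun l => hw0 _) (fun j => ?_) hgeom
    simp only [w]
    rw [tsum_mul_left, (hsum j).tsum_eq]
    calc (2 : ℝ) ^ (γ * j) * S j ≤ (2 : ℝ) ^ (γ * j) * (M * h j ^ (2 * α)) := by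
          gcongr
          exact hS j
      _ = _ := by
          simp only [h]
          rw [Real.mul_rpow (by positivity) (by positivity), ← Real.rpow_mul (by norm_num),
            ← Real.rpow_natCast, ← Real.rpow_mul (by norm_num),
            show (γ - 2 * α) * (j : ℝ) = γ * j + -j * (2 * α) by ring,
            Real.rpow_add (by norm_num)]
          ring
  -- From the double family only the term of each `l` in its own dyadic block is kept.
  let b : ℤ → ℕ := fun l => Nat.log 2 l.natAbs
  have hcomp : Summable fun l : ℤ => w (b l, l) :=
    hwsum.comp_injective (i := fun l : ℤ => (b l, l)) fun l l' hl => (Prod.ext_iff.1 hl).2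
  have hmain : Summable fun l : ℤ => w (b l, l) + (2 : ℝ) ^ γ * |(l : ℝ)| ^ (-γ) :=
    hcomp.add ((Real.summable_abs_int_rpow hγ1).mul_left _)
  refine Summable.of_norm_bounded_eventually hmain ?_
  filter_upwards [(Set.finite_singleton (0 : ℤ)).compl_mem_cofinite] with l hl
  have hl0 : l.natAbs ≠ 0 := by simpa using hl
  have hlow : (2 : ℝ) ^ (b l : ℝ) ≤ |(l : ℝ)| := by
    have := Nat.pow_log_le_self 2 hl0
    rw [Real.rpow_natCast, ← Int.cast_abs, ← Nat.cast_natAbs]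
    exact_mod_cast this
  have hupp : |(l : ℝ)| ≤ 2 * (2 : ℝ) ^ (b l : ℝ) := by
    have := (Nat.lt_pow_succ_log_self (b := 2) (by norm_num) l.natAbs).le
    rw [Real.rpow_natCast, ← Int.cast_abs, ← Nat.cast_natAbs, ← pow_succ']
    exact_mod_cast this
  have hpos : (0 : ℝ) < 2 ^ (b l : ℝ) := by positivity
  have hlpos : 0 < |(l : ℝ)| := hpos.trans_le hlow
  have h3 : 3 ≤ ‖Complex.exp (Complex.I * l * freq T * h (b l)) - 1‖ ^ 2 := by
    have e : Complex.I * l * freq T * h (b l) =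
        ((2 * Real.pi / 3 * (l * (2 : ℝ) ^ (-(b l : ℝ))) : ℝ) : ℂ) * Complex.I := by
      simp only [freq, h]
      have hT' : (T : ℂ) ≠ 0 := by exact_mod_cast hT.ne'
      push_cast
      field_simp
    rw [e]
    have habs : |2 * Real.pi / 3 * (l * (2 : ℝ) ^ (-(b l : ℝ)))| =
        2 * Real.pi / 3 * (|(l : ℝ)| / (2 : ℝ) ^ (b l : ℝ)) := by
      rw [abs_mul, abs_mul, abs_of_pos (by positivity : 0 < 2 * Real.pi / 3),
        abs_of_pos (by positivity : (0 : ℝ) < 2 ^ (-(b l : ℝ))), Real.rpow_neg (by norm_num),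
        div_eq_mul_inv _ ((2 : ℝ) ^ (b l : ℝ))]
    have hpi : 0 ≤ 2 * Real.pi / 3 := by positivity
    apply three_le_norm_exp_sub_one_sq <;> rw [habs]
    · exact le_mul_of_one_le_right hpi ((one_le_div hpos).2 hlow)
    · have : |(l : ℝ)| / (2 : ℝ) ^ (b l : ℝ) ≤ 2 := (div_le_iff₀ hpos).2 hupp
      nlinarith
  have hkey : 3 * (2 : ℝ) ^ (γ * b l) * a l ^ 2 ≤ w (b l, l) := by
    simp only [w]
    have : 0 ≤ (2 : ℝ) ^ (γ * b l) * a l ^ 2 := by positivity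
    nlinarith
  have hinv : ((2 : ℝ) ^ (γ * b l))⁻¹ ≤ 2 ^ γ * |(l : ℝ)| ^ (-γ) := by
    rw [mul_comm γ, Real.rpow_mul (by norm_num), Real.rpow_neg hlpos.le,
      ← div_eq_mul_inv, le_div_iff₀ (by positivity), inv_mul_le_iff₀ (by positivity),
      ← Real.mul_rpow hpos.le (by norm_num), mul_comm _ (2 : ℝ)]
    exact Real.rpow_le_rpow hlpos.le hupp (by linarith)
  have hu : 0 < (2 : ℝ) ^ (γ * b l) := by positivity
  -- The arithmetic-geometric mean inequality replaces Cauchy–Schwarz on each block.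
  have hag : a l ≤ (2 : ℝ) ^ (γ * b l) * a l ^ 2 + ((2 : ℝ) ^ (γ * b l))⁻¹ := by
    set u := (2 : ℝ) ^ (γ * b l)
    have h1 : 0 ≤ u⁻¹ * (u * a l - 1) ^ 2 := by positivity
    have h2 : u⁻¹ * (u * a l - 1) ^ 2 = u * a l ^ 2 - 2 * a l + u⁻¹ := by
      field_simp
      ring
    have h3 := ha0 l
    linarith
  have : 0 ≤ (2 : ℝ) ^ (γ * b l) * a l ^ 2 := by positivity
  rw [← congrFun ha l]
  linarith

end Bernstein

/-! ### Exponential and resolvent of a matrix with simple spectrum -/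

section SpectralProjections

variable {n : ℕ} (A : Matrix (Fin n) (Fin n) ℂ) (lam : Fin n → ℂ)

/-- The spectral projection of `A` onto the eigenspace of the simple eigenvalue `lam j`. -/
def spectralProj (j : Fin n) : Matrix (Fin n) (Fin n) ℂ :=
  Polynomial.aeval A (Lagrange.basis Finset.univ lam j)

variable {A lam}

theorem sum_spectralProj (hsimple : Function.Injective lam) : ∑ j, spectralProj A lam j = 1 := by
  rcases isEmpty_or_nonempty (Fin n) with h | h
  · exact Subsingleton.elim _ _
  · simp only [spectralProj]
    rw [← map_sum, Lagrange.sum_basis hsimple.injOn Finset.univ_nonempty, map_one]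

/-- Up to a constant factor, `X - λ_j` times the Lagrange polynomial is the characteristic
polynomial, so Cayley–Hamilton applies. -/
theorem mul_spectralProj (hlam : A.charpoly = ∏ j, (Polynomial.X - Polynomial.C (lam j)))
    (j : Fin n) : A * spectralProj A lam j = lam j • spectralProj A lam j := by
  have hdvd : A.charpoly ∣ (Polynomial.X - Polynomial.C (lam j)) *
      Lagrange.basis Finset.univ lam j := by
    rw [hlam, ← Finset.mul_prod_erase _ _ (Finset.mem_univ j), Lagrange.basis]
    refine mul_dvd_mul_left _ (Finset.prod_dvd_prod_of_dvd _ _ fun i _ => ?_)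
    rw [Lagrange.basisDivisor]
    exact dvd_mul_left _ _
  obtain ⟨q, hq⟩ := hdvd
  have h := congrArg (Polynomial.aeval A) hq
  rw [map_mul, map_mul, Matrix.aeval_self_charpoly, zero_mul, map_sub, Polynomial.aeval_X,
    Polynomial.aeval_C, sub_mul, sub_eq_zero, Algebra.algebraMap_eq_smul_one, smul_mul_assoc,
    one_mul] at h
  exact h

open scoped Matrix.Norms.Operator in
theorem exp_mul_of_mul_eq_smul {B P : Matrix (Fin n) (Fin n) ℂ} {μ : ℂ} (h : B * P = μ • P) :
    NormedSpace.exp B * P = Complex.exp μ • P := by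
  have hpow : ∀ k : ℕ, B ^ k * P = μ ^ k • P := fun k => by
    induction k with
    | zero => simp
    | succ k ih => rw [pow_succ, mul_assoc, h, mul_smul_comm, ih, smul_smul, pow_succ']
  have h1 := (NormedSpace.exp_series_hasSum_exp' (𝕂 := ℂ) B).mul_right P
  have h2 := (NormedSpace.exp_series_hasSum_exp' (𝕂 := ℂ) μ).smul_const P
  rw [Complex.exp_eq_exp_ℂ]
  refine h1.unique (h2.congr_fun fun k => ?_)
  rw [smul_mul_assoc, hpow, smul_eq_mul, mul_smul]

theorem exp_smul_eq_sum (hlam : A.charpoly = ∏ j, (Polynomial.X - Polynomial.C (lam j)))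
    (hsimple : Function.Injective lam) (r : ℂ) :
    NormedSpace.exp (r • A) = ∑ j, Complex.exp (lam j * r) • spectralProj A lam j := by
  rw [← mul_one (NormedSpace.exp (r • A)), ← sum_spectralProj (A := A) hsimple, Finset.mul_sum]
  refine Finset.sum_congr rfl fun j _ => exp_mul_of_mul_eq_smul ?_
  rw [smul_mul_assoc, mul_spectralProj hlam, smul_smul, mul_comm]

theorem resolvent_eq_sum (hlam : A.charpoly = ∏ j, (Polynomial.X - Polynomial.C (lam j)))
    (hsimple : Function.Injective lam) {s : ℂ} (hs : ∀ j, s ≠ lam j) :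
    (s • (1 : Matrix (Fin n) (Fin n) ℂ) - A)⁻¹ =
      ∑ j, (s - lam j)⁻¹ • spectralProj A lam j := by
  refine Matrix.inv_eq_right_inv ?_
  rw [Finset.mul_sum]
  refine (Finset.sum_congr rfl fun j _ => ?_).trans (sum_spectralProj (A := A) hsimple)
  rw [mul_smul_comm, sub_mul, mul_spectralProj hlam, smul_mul_assoc, one_mul, ← sub_smul,
    smul_smul, inv_mul_cancel₀ (sub_ne_zero.2 (hs j)), one_smul]

open scoped Matrix.Norms.Operator in
theorem map_ofReal_exp (B : Matrix (Fin n) (Fin n) ℝ) :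
    (NormedSpace.exp B).map Complex.ofReal = NormedSpace.exp (B.map Complex.ofReal) := by
  have := NormedSpace.map_exp (Complex.ofRealHom.mapMatrix (m := Fin n))
    (Continuous.matrix_map continuous_id Complex.continuous_ofReal) B
  simp only [RingHom.mapMatrix_apply] at this
  exact this

end SpectralProjections

/-! ### Poles and residues of series of simple fractions -/

section PartialFractions

variable {X : Type*} {a p : X → ℂ} {F : ℂ → ℂ} {z₀ : ℂ} {ε : ℝ}

/-- Near `z₀`, a convergent series of simple fractions is the sum of its principal part and of a
holomorphic function. -/
theorem exists_principalPart (ha : Summable fun x => ‖a x‖) (hε : 0 < ε)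
    (hp : ∀ x, p x = z₀ ∨ 2 * ε ≤ dist (p x) z₀)
    (hF : ∀ z, (∀ x, z ≠ p x) → F z = ∑' x, a x / (z - p x)) :
    ∃ R : ℂ → ℂ, DifferentiableOn ℂ R (Metric.ball z₀ ε) ∧ ∀ z ∈ Metric.ball z₀ ε, z ≠ z₀ →
      F z = (∑' x, {x | p x = z₀}.indicator a x) * (z - z₀)⁻¹ + R z := by
  classical
  -- Only the terms with poles away from `z₀` are kept. The gap `2 * ε` leaves distance at least `ε`
  -- from every point of the ball, hence uniform convergence there.
  let f : X → ℂ → ℂ := fun x z => {x | p x = z₀}ᶜ.indicator a x / (z - p x)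
  have hdist : ∀ x, p x ≠ z₀ → ∀ z ∈ Metric.ball z₀ ε, ε ≤ ‖z - p x‖ := fun x hx z hz => by
    have h1 := (hp x).resolve_left hx
    have h2 := dist_triangle (p x) z z₀
    rw [Metric.mem_ball] at hz
    rw [← dist_eq_norm, dist_comm]
    linarith
  have hbound : ∀ x, ∀ z ∈ Metric.ball z₀ ε, ‖f x z‖ ≤ ‖a x‖ * ε⁻¹ := fun x z hz => by
    by_cases hx : p x = z₀
    · have : f x z = 0 := by simp [f, hx]
      rw [this, norm_zero]
      positivity
    · have : f x z = a x / (z - p x) := by simp [f, hx]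
      rw [this, norm_div, div_eq_mul_inv]
      gcongr
      exact hdist x hx z hz
  refine ⟨fun z => ∑' x, f x z, ?_, fun z hz hne => ?_⟩
  · refine Complex.differentiableOn_tsum_of_summable_norm (ha.mul_right ε⁻¹) (fun x => ?_)
      Metric.isOpen_ball hbound
    · by_cases hx : p x = z₀
      · simp [f, hx]
      · refine DifferentiableOn.div (differentiableOn_const _) (by fun_prop) fun z hz => ?_
        exact norm_pos_iff.1 (hε.trans_le (hdist x hx z hz))
  · have hnp : ∀ x, z ≠ p x := fun x hzx => by
      by_cases hx : p x = z₀
      · exact hne (hzx.trans hx)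
      · have := hdist x hx z hz
        rw [hzx, sub_self, norm_zero] at this
        linarith
    rw [hF z hnp, ← tsum_mul_right, ← Summable.tsum_add]
    · refine tsum_congr fun x => ?_
      by_cases hx : p x = z₀
      · simp [f, hx, div_eq_mul_inv]
      · simp [f, hx]
    · exact (ha.of_norm.indicator _).mul_right _
    · exact Summable.of_norm_bounded (ha.mul_right ε⁻¹) fun x => hbound x z hz

theorem meromorphicAt_of_principalPart (hε : 0 < ε) {R : ℂ → ℂ} {A : ℂ}
    (hR : DifferentiableOn ℂ R (Metric.ball z₀ ε))
    (hF : ∀ z ∈ Metric.ball z₀ ε, z ≠ z₀ → F z = A * (z - z₀)⁻¹ + R z) :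
    MeromorphicAt F z₀ := by
  have hRa : AnalyticAt ℂ R z₀ := hR.analyticAt (Metric.ball_mem_nhds _ hε)
  have h1 : MeromorphicAt (fun z => A * (z - z₀)⁻¹ + R z) z₀ :=
    ((MeromorphicAt.const A z₀).mul
      ((MeromorphicAt.id z₀).sub (MeromorphicAt.const z₀ z₀)).inv).add hRa.meromorphicAt
  refine h1.congr ?_
  filter_upwards [self_mem_nhdsWithin, mem_nhdsWithin_of_mem_nhds (Metric.ball_mem_nhds z₀ hε)]
    with z hz hzb
  exact (hF z hzb hz).symm

/-- Cauchy's theorem removes `R`, so the normalised circle integral equals `A` for every radius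
below `ε`: the limit is that of an eventually constant function. -/
theorem residue_of_principalPart (hε : 0 < ε) {R : ℂ → ℂ} {A : ℂ}
    (hR : DifferentiableOn ℂ R (Metric.ball z₀ ε))
    (hF : ∀ z ∈ Metric.ball z₀ ε, z ≠ z₀ → F z = A * (z - z₀)⁻¹ + R z) :
    residue F z₀ = A := by
  refine Filter.Tendsto.limUnder_eq (tendsto_const_nhds.congr' ?_)
  filter_upwards [self_mem_nhdsWithin, mem_nhdsWithin_of_mem_nhds (Iio_mem_nhds hε)] with δ hδ hδε
  have hδ : 0 < δ := hδ
  have hδε : δ < ε := hδε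
  have hsub : Metric.closedBall z₀ δ ⊆ Metric.ball z₀ ε := Metric.closedBall_subset_ball hδε
  have h1 : ∮ z in C(z₀, δ), F z = ∮ z in C(z₀, δ), (A * (z - z₀)⁻¹ + R z) := by
    refine circleIntegral.integral_congr hδ.le fun z hz => hF z ?_ ?_
    · exact hsub (Metric.sphere_subset_closedBall hz)
    · exact Metric.ne_of_mem_sphere hz hδ.ne'
  have hi1 : CircleIntegrable (fun z => A * (z - z₀)⁻¹) z₀ δ := by
    refine ContinuousOn.circleIntegrable hδ.le (ContinuousOn.mul continuousOn_const
      (ContinuousOn.inv₀ (by fun_prop) fun z hz => ?_))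
    exact sub_ne_zero.2 (Metric.ne_of_mem_sphere hz hδ.ne')
  have hi2 : CircleIntegrable R z₀ δ :=
    (hR.continuousOn.mono (Metric.sphere_subset_closedBall.trans hsub)).circleIntegrable hδ.le
  have hR0 : ∮ z in C(z₀, δ), R z = 0 :=
    Complex.circleIntegral_eq_zero_of_differentiable_on_off_countable hδ.le Set.countable_empty
      (hR.continuousOn.mono hsub) fun z hz => hR.differentiableAt
        (Metric.isOpen_ball.mem_nhds (hsub (Metric.ball_subset_closedBall hz.1)))
  rw [h1, circleIntegral.integral_add hi1 hi2, hR0, add_zero, circleIntegral.integral_const_mul,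
    circleIntegral.integral_sub_center_inv _ hδ.ne']
  have := Real.pi_ne_zero
  field_simp

end PartialFractions

/-! ### Termwise integration of decaying exponentials -/

section ExponentialSeries

open MeasureTheory Set

variable {Y : Type*} {a q : Y → ℂ} {δ : ℝ}

theorem norm_exp_mul_le {μ : ℂ} (hμ : μ.re ≤ -δ) {r : ℝ} (hr : 0 ≤ r) :
    ‖Complex.exp (μ * r)‖ ≤ Real.exp (-δ * r) := by
  rw [Complex.norm_exp, Complex.re_mul_ofReal]
  gcongr

theorem norm_exp_mul_le_one {μ : ℂ} (hδ : 0 ≤ δ) (hμ : μ.re ≤ -δ) {r : ℝ} (hr : 0 ≤ r) :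
    ‖Complex.exp (μ * r)‖ ≤ 1 :=
  (norm_exp_mul_le hμ hr).trans (Real.exp_le_one_iff.2 (by nlinarith))

theorem norm_inv_neg_le {μ : ℂ} (hδ : 0 < δ) (hμ : μ.re ≤ -δ) : ‖(-μ)⁻¹‖ ≤ δ⁻¹ := by
  rw [norm_inv]
  have : δ ≤ ‖-μ‖ := by
    have := Complex.re_le_norm (-μ)
    rw [Complex.neg_re] at this
    linarith
  gcongr

/-- Uniform convergence makes the sum continuous, hence measurable, and `(∑ ‖a y‖) e^{-δ r}`
dominates it. -/
theorem integrableOn_expSeries (hδ : 0 < δ) (ha : Summable fun y => ‖a y‖)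
    (hq : ∀ y, (q y).re ≤ -δ) {f : ℝ → ℂ}
    (hf : ∀ r : ℝ, 0 < r → HasSum (fun y => a y * Complex.exp (q y * r)) (f r)) :
    IntegrableOn f (Ioi 0) := by
  have hcont : ContinuousOn (fun r : ℝ => ∑' y, a y * Complex.exp (q y * r)) (Ioi 0) := by
    refine continuousOn_tsum (fun y => by fun_prop) ha fun y r hr => ?_
    rw [norm_mul]
    exact mul_le_of_le_one_right (norm_nonneg _) (norm_exp_mul_le_one hδ.le (hq y) (le_of_lt hr))
  have hmeas : AEStronglyMeasurable f (volume.restrict (Ioi 0)) :=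
    (hcont.congr fun r hr => (hf r hr).tsum_eq.symm).aestronglyMeasurable measurableSet_Ioi
  refine Integrable.mono' (g := fun r => (∑' y, ‖a y‖) * Real.exp (-δ * r)) ?_ hmeas ?_
  · exact ((integrableOn_exp_mul_Ioi (by linarith) 0).const_mul _)
  · filter_upwards [ae_restrict_mem measurableSet_Ioi] with r hr
    refine (hf r hr).tsum_eq ▸ tsum_of_norm_bounded (ha.hasSum.mul_right _) fun y => ?_
    rw [norm_mul]
    gcongr
    exact norm_exp_mul_le (hq y) (le_of_lt hr)

theorem hasSum_integral_expSeries [Countable Y] (hδ : 0 < δ) (ha : Summable fun y => ‖a y‖)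
    (hq : ∀ y, (q y).re ≤ -δ) {f : ℝ → ℂ}
    (hf : ∀ r : ℝ, 0 < r → HasSum (fun y => a y * Complex.exp (q y * r)) (f r)) :
    HasSum (fun y => a y * (-q y)⁻¹) (∫ r in Ioi (0 : ℝ), f r) := by
  have hneg : ∀ y, (q y).re < 0 := fun y => (hq y).trans_lt (by linarith)
  have hint : ∀ y, IntegrableOn (fun r : ℝ => a y * Complex.exp (q y * r)) (Ioi 0) := fun y =>
    (integrableOn_exp_mul_complex_Ioi (hneg y) 0).const_mul _
  have hbound : ∀ y, ∫ r in Ioi (0 : ℝ), ‖a y * Complex.exp (q y * r)‖ ≤ ‖a y‖ * δ⁻¹ := fun y => by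
    have h1 : ∫ r in Ioi (0 : ℝ), ‖a y * Complex.exp (q y * r)‖ ≤
        ∫ r in Ioi (0 : ℝ), ‖a y‖ * Real.exp (-δ * r) := by
      refine setIntegral_mono_on (hint y).norm
        ((integrableOn_exp_mul_Ioi (by linarith) 0).const_mul _) measurableSet_Ioi fun r hr => ?_
      rw [norm_mul]
      gcongr
      exact norm_exp_mul_le (hq y) (le_of_lt hr)
    rwa [integral_const_mul, integral_exp_mul_Ioi (by linarith), mul_zero, Real.exp_zero,
      neg_div_neg_eq, one_div] at h1
  have hs := hasSum_integral_of_summable_integral_norm hint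
    (Summable.of_nonneg_of_le (fun y => integral_nonneg fun r => norm_nonneg _) hbound
      (ha.mul_right _))
  have hval : ∀ y, ∫ r in Ioi (0 : ℝ), a y * Complex.exp (q y * r) = a y * (-q y)⁻¹ := fun y => by
    rw [integral_const_mul, integral_exp_mul_complex_Ioi (hneg y)]
    simp [neg_div, inv_neg]
  simp only [hval] at hs
  rwa [setIntegral_congr_fun measurableSet_Ioi fun r hr => (hf r hr).tsum_eq] at hs

/-- Termwise Laplace transform of a series of decaying exponentials. -/
theorem laplace_expSeries [Countable Y] (hδ : 0 < δ) (ha : Summable fun y => ‖a y‖)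
    (hq : ∀ y, (q y).re ≤ -δ) {f : ℝ → ℂ}
    (hf : ∀ r : ℝ, 0 < r → HasSum (fun y => a y * Complex.exp (q y * r)) (f r)) {s : ℂ}
    (hs : 0 < s.re) :
    IntegrableOn (fun r : ℝ => Complex.exp (-(s * r)) * f r) (Ioi 0) ∧
      HasSum (fun y => a y / (s - q y)) (∫ r in Ioi (0 : ℝ), Complex.exp (-(s * r)) * f r) := by
  have hq' : ∀ y, (q y - s).re ≤ -δ := fun y => by
    rw [Complex.sub_re]
    linarith [hq y]
  have hf' : ∀ r : ℝ, 0 < r → HasSum (fun y => a y * Complex.exp ((q y - s) * r))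
      (Complex.exp (-(s * r)) * f r) := fun r hr => by
    refine ((hf r hr).mul_left (Complex.exp (-(s * r)))).congr_fun fun y => ?_
    rw [sub_mul, sub_eq_add_neg, Complex.exp_add]
    ring
  refine ⟨integrableOn_expSeries hδ ha hq' hf', ?_⟩
  simpa only [neg_sub, div_eq_mul_inv] using hasSum_integral_expSeries hδ ha hq' hf'

end ExponentialSeries

/-! ### Pairing of mode expansions -/

section Pairing

open MeasureTheory Set

variable {X : Type*} {T δ : ℝ} {p : X → ℂ} {φ ψ : ℤ × X → ℂ}

/-- The mode `e^{p_x r} e^{i k ω₀ t}` with index `(k, x)`. -/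
def mode (T : ℝ) (p : X → ℂ) (y : ℤ × X) (t r : ℝ) : ℂ :=
  Complex.exp (Complex.I * y.1 * freq T * t) * Complex.exp (p y.2 * r)

theorem norm_exp_I_freq (k : ℤ) (t : ℝ) : ‖Complex.exp (Complex.I * k * freq T * t)‖ = 1 := by
  have : Complex.I * k * freq T * t = ((k * freq T * t : ℝ) : ℂ) * Complex.I := by
    push_cast
    ring
  rw [this, Complex.norm_exp_ofReal_mul_I]

theorem norm_mode_le (hp : ∀ x, (p x).re ≤ -δ) (y : ℤ × X) (t : ℝ) {r : ℝ} (hr : 0 ≤ r) :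
    ‖mode T p y t r‖ ≤ Real.exp (-δ * r) := by
  rw [mode, norm_mul, norm_exp_I_freq, one_mul]
  exact norm_exp_mul_le (hp _) hr

theorem conj_exp_I_freq (k : ℤ) (t : ℝ) :
    conj (Complex.exp (Complex.I * k * freq T * t)) = Complex.exp (-(Complex.I * k * freq T * t)) := by
  rw [← Complex.exp_conj]
  simp only [map_mul, Complex.conj_I, Complex.conj_ofReal, map_intCast]
  congr 1
  ring

theorem integral_exp_I_freq (hT : 0 < T) (k k' : ℤ) :
    (1 / (T : ℂ)) * ∫ t in (0 : ℝ)..T, conj (Complex.exp (Complex.I * k * freq T * t)) *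
      Complex.exp (Complex.I * k' * freq T * t) = if k = k' then 1 else 0 := by
  have hT' : (T : ℂ) ≠ 0 := by exact_mod_cast hT.ne'
  have hpi : (Real.pi : ℂ) ≠ 0 := by exact_mod_cast Real.pi_ne_zero
  have h1 : ∀ t : ℝ, conj (Complex.exp (Complex.I * k * freq T * t)) *
      Complex.exp (Complex.I * k' * freq T * t) =
        Complex.exp (Complex.I * (k' - k : ℤ) * freq T * t) := fun t => by
    rw [conj_exp_I_freq, ← Complex.exp_add]
    congr 1
    push_cast
    ring
  simp only [h1]
  split_ifs with h
  · simp [h, hT']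
  · have hk : ((k' - k : ℤ) : ℂ) ≠ 0 := by
      exact_mod_cast sub_ne_zero.2 (Ne.symm h)
    have hc : Complex.I * (k' - k : ℤ) * freq T ≠ 0 := by
      refine mul_ne_zero (mul_ne_zero Complex.I_ne_zero hk) ?_
      exact_mod_cast (by unfold freq; positivity : freq T ≠ 0)
    rw [integral_exp_mul_complex hc]
    have : Complex.I * (k' - k : ℤ) * freq T * T = (k' - k : ℤ) * (2 * Real.pi * Complex.I) := by
      simp only [freq]
      push_cast
      field_simp
    rw [this, Complex.exp_int_mul_two_pi_mul_I]
    simp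

theorem summable_norm_mul_mode (hδ : 0 < δ) (hp : ∀ x, (p x).re ≤ -δ)
    (hφ : Summable fun y => ‖φ y‖) (t : ℝ) {r : ℝ} (hr : 0 ≤ r) :
    Summable fun y => ‖φ y * mode T p y t r‖ :=
  Summable.of_nonneg_of_le (fun _ => norm_nonneg _) (fun y => by
    rw [norm_mul]
    exact mul_le_of_le_one_right (norm_nonneg _)
      ((norm_mode_le hp y t hr).trans (Real.exp_le_one_iff.2 (by nlinarith)))) hφ

theorem summable_div_neg_conj_sub (hδ : 0 < δ) (hp : ∀ x, (p x).re ≤ -δ) {a : X → ℂ}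
    (ha : Summable fun x => ‖a x‖) (x' : X) :
    Summable fun x => ‖a x / (-conj (p x') - p x)‖ := by
  refine Summable.of_nonneg_of_le (fun _ => norm_nonneg _) (fun x => ?_)
    (ha.mul_right (2 * δ)⁻¹)
  have h : (conj (p x') + p x).re ≤ -(2 * δ) := by
    rw [Complex.add_re, Complex.conj_re]
    linarith [hp x, hp x']
  have := norm_inv_neg_le (by positivity) h
  rw [neg_add, ← sub_eq_add_neg] at this
  rw [div_eq_mul_inv, norm_mul]
  gcongr

/-- Regrouping of a double series of products that lives on the diagonal `k = k'`. -/
theorem hasSum_diagonal (hδ : 0 < δ) (hp : ∀ x, (p x).re ≤ -δ)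
    (hφ : Summable fun y => ‖φ y‖) {S : ℂ}
    (hS : HasSum (fun z : (ℤ × X) × (ℤ × X) => if z.1.1 = z.2.1 then
      conj (φ z.1) * ψ z.2 * (-(conj (p z.1.2) + p z.2.2))⁻¹ else 0) S) :
    HasSum (fun y : ℤ × X => conj (∑' x, φ (y.1, x) / (-conj (p y.2) - p x)) * ψ y) S := by
  -- The swap makes the mode of `ψ` the outer index; the diagonal condition then reduces the inner
  -- sum to the modes of `φ` with the same `k`.
  rw [← (Equiv.prodComm _ _).hasSum_iff] at hS
  refine hS.prod_fiberwise fun y => ?_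
  have hinj : Function.Injective fun x : X => (y.1, x) := fun x x' hx => (Prod.ext_iff.1 hx).2
  refine (hinj.hasSum_iff fun u hu => ?_).1 ?_
  · have : u.1 ≠ y.1 := fun h => hu ⟨u.2, by rw [← h]⟩
    simp [this]
  · have hsx := (summable_div_neg_conj_sub hδ hp (hφ.comp_injective hinj) y.2).of_norm
    refine ((Complex.hasSum_conj'.2 hsx.hasSum).mul_right (ψ y)).congr_fun fun x => ?_
    -- This identity exhibits the integral over `r` as the conjugate of a simple fraction evaluated
    -- at `-conj (p y.2)`.
    have h1 : -(conj (p x) + p y.2) = conj (-conj (p y.2) - p x) := by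
      rw [map_sub, map_neg, Complex.conj_conj]
      ring
    simp only [Function.comp_apply, Equiv.prodComm_apply, Prod.swap_prod_mk, if_true]
    rw [h1, map_div₀, div_eq_mul_inv]
    ring

theorem hasSum_mul_of_summable_norm {Y Z : Type*} {f : Y → ℂ} {g : Z → ℂ} {a b : ℂ}
    (ha : HasSum f a) (hb : HasSum g b) (hf : Summable fun y => ‖f y‖)
    (hg : Summable fun z => ‖g z‖) : HasSum (fun x : Y × Z => f x.1 * g x.2) (a * b) :=
  ha.mul hb (summable_mul_of_summable_norm hf hg)

theorem hasSum_conj_mul_modes (hδ : 0 < δ) (hp : ∀ x, (p x).re ≤ -δ)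
    (hφ : Summable fun y => ‖φ y‖) (hψ : Summable fun y => ‖ψ y‖) {t r : ℝ} (hr : 0 < r) {a b : ℂ}
    (ha : HasSum (fun y => φ y * mode T p y t r) a)
    (hb : HasSum (fun y => ψ y * mode T p y t r) b) :
    HasSum (fun z : (ℤ × X) × (ℤ × X) => conj (φ z.1) * ψ z.2 *
      (conj (Complex.exp (Complex.I * z.1.1 * freq T * t)) *
        Complex.exp (Complex.I * z.2.1 * freq T * t)) *
      Complex.exp ((conj (p z.1.2) + p z.2.2) * r)) (conj a * b) := by
  have h1 : HasSum (fun y => conj (φ y * mode T p y t r)) (conj a) := Complex.hasSum_conj'.2 ha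
  have hs1 : Summable fun y => ‖conj (φ y * mode T p y t r)‖ := by
    simpa only [RCLike.norm_conj] using summable_norm_mul_mode (T := T) hδ hp hφ t hr.le
  have h3 := hasSum_mul_of_summable_norm h1 hb hs1 (summable_norm_mul_mode hδ hp hψ t hr.le)
  refine h3.congr_fun fun z => ?_
  have h2 : conj (Complex.exp (p z.1.2 * r)) = Complex.exp (conj (p z.1.2) * r) := by
    rw [← Complex.exp_conj, map_mul, Complex.conj_ofReal]
  rw [mode, mode, map_mul, map_mul, h2, add_mul, Complex.exp_add]
  ring

/-- Pairing of two series of modes over one period and the half-line. -/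
theorem hasSum_pairing [Countable X] (hT : 0 < T) (hδ : 0 < δ) (hp : ∀ x, (p x).re ≤ -δ)
    (hφ : Summable fun y => ‖φ y‖) (hψ : Summable fun y => ‖ψ y‖) {g h : ℝ → ℝ → ℂ}
    (hg : ∀ t r, 0 < r → HasSum (fun y => φ y * mode T p y t r) (g t r))
    (hh : ∀ t r, 0 < r → HasSum (fun y => ψ y * mode T p y t r) (h t r)) :
    HasSum (fun y : ℤ × X => conj (∑' x, φ (y.1, x) / (-conj (p y.2) - p x)) * ψ y)
      ((1 / (T : ℂ)) * ∫ t in (0 : ℝ)..T, ∫ r in Ioi (0 : ℝ), conj (g t r) * h t r) := by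
  have hq : ∀ z : (ℤ × X) × (ℤ × X), (conj (p z.1.2) + p z.2.2).re ≤ -(2 * δ) := fun z => by
    rw [Complex.add_re, Complex.conj_re]
    linarith [hp z.1.2, hp z.2.2]
  have hA : Summable fun z : (ℤ × X) × (ℤ × X) => ‖conj (φ z.1) * ψ z.2‖ := by
    have : Summable fun z : (ℤ × X) × (ℤ × X) => ‖φ z.1‖ * ‖ψ z.2‖ :=
      hφ.mul_of_nonneg hψ (fun _ => norm_nonneg _) fun _ => norm_nonneg _
    simpa only [norm_mul, RCLike.norm_conj] using this
  obtain ⟨e, he⟩ : ∃ e : (ℤ × X) × (ℤ × X) → ℝ → ℂ, e = fun (z : (ℤ × X) × (ℤ × X)) (t : ℝ) =>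
    conj (Complex.exp (Complex.I * z.1.1 * freq T * t)) *
      Complex.exp (Complex.I * z.2.1 * freq T * t) := ⟨_, rfl⟩
  have he1 : ∀ z t, ‖e z t‖ = 1 := fun z t => by
    rw [he, norm_mul, RCLike.norm_conj, norm_exp_I_freq, norm_exp_I_freq, one_mul]
  have hec : ∀ z, Continuous (e z) := fun z => by
    rw [he]
    fun_prop
  have hinner : ∀ t, HasSum (fun z : (ℤ × X) × (ℤ × X) =>
      conj (φ z.1) * ψ z.2 * e z t * (-(conj (p z.1.2) + p z.2.2))⁻¹)
      (∫ r in Ioi (0 : ℝ), conj (g t r) * h t r) := fun t =>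
    hasSum_integral_expSeries (by positivity)
      (by simpa only [norm_mul _ (e _ t), he1, mul_one] using hA) hq fun r hr => by
        rw [he]
        exact hasSum_conj_mul_modes hδ hp hφ hψ hr (hg t r hr) (hh t r hr)
  have houter : HasSum (fun z : (ℤ × X) × (ℤ × X) => ∫ t in (0 : ℝ)..T,
      conj (φ z.1) * ψ z.2 * e z t * (-(conj (p z.1.2) + p z.2.2))⁻¹)
      (∫ t in (0 : ℝ)..T, ∫ r in Ioi (0 : ℝ), conj (g t r) * h t r) := by
    refine intervalIntegral.hasSum_integral_of_dominated_convergence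
      (fun z _ => ‖conj (φ z.1) * ψ z.2‖ * (2 * δ)⁻¹) (fun z => ?_) (fun z => ?_) ?_ ?_ ?_
    · exact ((continuous_const.mul (hec z)).mul continuous_const).aestronglyMeasurable
    · refine Filter.Eventually.of_forall fun t _ => ?_
      rw [norm_mul, norm_mul _ (e z t), he1, mul_one]
      exact mul_le_mul_of_nonneg_left (norm_inv_neg_le (by positivity) (hq z)) (norm_nonneg _)
    · exact Filter.Eventually.of_forall fun t _ => hA.mul_right _
    · exact intervalIntegrable_const
    · exact Filter.Eventually.of_forall fun t _ => hinner t
  refine hasSum_diagonal hδ hp hφ ((houter.mul_left (1 / (T : ℂ))).congr_fun fun z => ?_)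
  rw [intervalIntegral.integral_mul_const, intervalIntegral.integral_const_mul, he]
  have := integral_exp_I_freq hT z.1.1 z.2.1
  rw [← mul_assoc, mul_left_comm, this]
  split_ifs <;> ring

end Pairing

/-! ### Rearrangement of sums -/

section Regrouping

/-- No summability of `F` is assumed: it is the finite sum of its restrictions to the slices. -/
theorem hasSum_prod_fintype {Y ι : Type*} [Fintype ι] {F : Y × ι → ℂ} {S : ι → ℂ}
    (hF : ∀ j, HasSum (fun y => F (y, j)) (S j)) : HasSum F (∑ j, S j) := by
  classical
  have h1 : ∀ j, HasSum (fun z : Y × ι => if z.2 = j then F z else 0) (S j) := fun j => by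
    have hinj : Function.Injective fun y : Y => (y, j) := fun y y' h => (Prod.ext_iff.1 h).1
    refine (hinj.hasSum_iff fun z hz => if_neg fun h => hz ⟨z.1, by rw [← h]⟩).1 ?_
    refine (hF j).congr_fun fun y => ?_
    simp
  refine (hasSum_sum fun j (_ : j ∈ Finset.univ) => h1 j).congr_fun fun z => ?_
  simp

/-- Summation by fibres of a map. -/
theorem hasSum_fiberwise {Y Z : Type*} {f : Y → ℂ} {S : ℂ} (hf : HasSum f S) (π : Y → Z) :
    HasSum (fun z => ∑' y, {y | π y = z}.indicator f y) S := by
  rw [← (Equiv.sigmaFiberEquiv π).hasSum_iff] at hf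
  refine hf.sigma fun z => ?_
  have := (hf.summable.sigma_factor z).hasSum
  rwa [show ∑' c : { y // π y = z }, (f ∘ (Equiv.sigmaFiberEquiv π)) ⟨z, c⟩ =
    ∑' y, {y | π y = z}.indicator f y from tsum_subtype {y | π y = z} f] at this

end Regrouping

/-! ### Subsystems as exponential series -/

section Modes

open MeasureTheory Set

variable {X : Type*} [Countable X] {T δ : ℝ} {p : X → ℂ} {φ : ℤ × X → ℂ}

/-- Fourier coefficients of a series of modes. -/
theorem hasSum_fourierCoef_modes (hT : 0 < T) (hδ : 0 < δ) (hp : ∀ x, (p x).re ≤ -δ)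
    (hφ : Summable fun y => ‖φ y‖) {r : ℝ} (hr : 0 < r) {g : ℝ → ℂ}
    (hg : ∀ t, HasSum (fun y => φ y * mode T p y t r) (g t)) (k : ℤ) :
    HasSum (fun x => φ (k, x) * Complex.exp (p x * r)) (fourierCoef T g k) := by
  have h1 : ∀ t : ℝ, HasSum (fun y => φ y * Complex.exp (p y.2 * r) *
      (conj (Complex.exp (Complex.I * k * freq T * t)) *
        Complex.exp (Complex.I * y.1 * freq T * t)))
      (Complex.exp (-(Complex.I * k * freq T * t)) * g t) := fun t => by
    refine ((hg t).mul_left _).congr_fun fun y => ?_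
    rw [mode, conj_exp_I_freq]
    ring
  have h2 : HasSum (fun y : ℤ × X => ∫ t in (0 : ℝ)..T, φ y * Complex.exp (p y.2 * r) *
      (conj (Complex.exp (Complex.I * k * freq T * t)) *
        Complex.exp (Complex.I * y.1 * freq T * t)))
      (∫ t in (0 : ℝ)..T, Complex.exp (-(Complex.I * k * freq T * t)) * g t) := by
    refine intervalIntegral.hasSum_integral_of_dominated_convergence
      (fun y _ => ‖φ y‖) (fun y => ?_) (fun y => ?_) ?_ intervalIntegrable_const ?_
    · exact Continuous.aestronglyMeasurable (by fun_prop)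
    · refine Filter.Eventually.of_forall fun t _ => ?_
      rw [norm_mul, norm_mul, norm_mul (conj _), RCLike.norm_conj, norm_exp_I_freq,
        norm_exp_I_freq, one_mul, mul_one]
      exact mul_le_of_le_one_right (norm_nonneg _) (norm_exp_mul_le_one hδ.le (hp _) hr.le)
    · exact Filter.Eventually.of_forall fun t _ => hφ
    · exact Filter.Eventually.of_forall fun t _ => h1 t
  have h3 := h2.mul_left (1 / (T : ℂ))
  have hinj : Function.Injective fun x : X => (k, x) := fun x x' h => (Prod.ext_iff.1 h).2
  have h4 : ∀ y : ℤ × X, (1 / (T : ℂ)) * ∫ t in (0 : ℝ)..T, φ y * Complex.exp (p y.2 * r) *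
      (conj (Complex.exp (Complex.I * k * freq T * t)) *
        Complex.exp (Complex.I * y.1 * freq T * t)) =
      if k = y.1 then φ y * Complex.exp (p y.2 * r) else 0 := fun y => by
    rw [intervalIntegral.integral_const_mul, mul_left_comm, integral_exp_I_freq hT]
    split_ifs <;> ring
  simp only [h4] at h3
  rw [← hinj.hasSum_iff fun y hy => if_neg fun h => hy ⟨y.2, by rw [h]⟩] at h3
  refine h3.congr_fun fun x => ?_
  simp

end Modes

/-! ### Location of the shifted eigenvalues -/

section Poles

variable {n : ℕ} {T : ℝ} {lam : Fin n → ℂ}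

theorem pole_re (l : ℤ) (j : Fin n) : (pole T lam l j).re = (lam j).re := by
  simp [pole]

theorem exists_decay_rate (hstable : ∀ j, (lam j).re < 0) :
    ∃ δ : ℝ, 0 < δ ∧ ∀ j, (lam j).re ≤ -δ := by
  have h1 : ∀ᶠ δ in nhdsWithin (0 : ℝ) (Set.Ioi 0), ∀ j, (lam j).re ≤ -δ := by
    rw [Filter.eventually_all]
    intro j
    filter_upwards [mem_nhdsWithin_of_mem_nhds (Iio_mem_nhds (neg_pos.2 (hstable j)))] with δ hδ
    have : δ < -(lam j).re := hδ
    linarith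
  obtain ⟨δ, hδ, hδ0⟩ := (h1.and self_mem_nhdsWithin).exists
  exact ⟨δ, hδ0, hδ⟩

/-- The points `λ_j^{(ℓ)}` have no accumulation point. -/
theorem exists_pole_separation (hT : 0 < T) (lam : Fin n → ℂ) (z₀ : ℂ) :
    ∃ ε : ℝ, 0 < ε ∧ ∀ x : ℤ × Fin n,
      pole T lam x.1 x.2 = z₀ ∨ 2 * ε ≤ dist (pole T lam x.1 x.2) z₀ := by
  have hω : 0 < freq T := by unfold freq; positivity
  -- Within distance 1 of `z₀`, `|ℓ| ω₀` is at most `1 + ‖z₀‖ + ∑ ‖λ_j‖`, so only finitely many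
  -- indices matter; the others are covered by `ε < 1 / 2`.
  have hfin : {x : ℤ × Fin n | dist (pole T lam x.1 x.2) z₀ < 1}.Finite := by
    obtain ⟨N, hN⟩ := exists_nat_gt ((1 + ‖z₀‖ + ∑ j, ‖lam j‖) / freq T)
    rw [div_lt_iff₀ hω] at hN
    refine ((Set.finite_Icc (-(N : ℤ)) N).prod (Set.finite_univ (α := Fin n))).subset
      fun x hx => ⟨abs_le.1 ?_, Set.mem_univ _⟩
    have hx : ‖lam x.2 - Complex.I * x.1 * freq T - z₀‖ < 1 := by
      rw [← dist_eq_norm]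
      exact hx
    have h1 : ‖Complex.I * x.1 * freq T‖ = |(x.1 : ℝ)| * freq T := by
      rw [norm_mul, norm_mul, Complex.norm_I, one_mul, Complex.norm_intCast, Complex.norm_real,
        Real.norm_of_nonneg hω.le]
    have h2 : ‖Complex.I * x.1 * freq T‖ ≤
        ‖lam x.2 - z₀‖ + ‖lam x.2 - Complex.I * x.1 * freq T - z₀‖ := by
      have := norm_sub_le (lam x.2 - z₀) (lam x.2 - Complex.I * x.1 * freq T - z₀)
      rwa [show lam x.2 - z₀ - (lam x.2 - Complex.I * x.1 * freq T - z₀) =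
        Complex.I * x.1 * freq T by ring] at this
    have h3 := norm_sub_le (lam x.2) z₀
    have h4 : ‖lam x.2‖ ≤ ∑ j, ‖lam j‖ :=
      Finset.single_le_sum (f := fun j => ‖lam j‖) (fun j _ => norm_nonneg _) (Finset.mem_univ x.2)
    have h5 : |(x.1 : ℝ)| * freq T < N * freq T := by linarith
    have h6 := (mul_lt_mul_iff_left₀ hω).1 h5
    exact_mod_cast h6.le
  have h1 : ∀ᶠ ε in nhdsWithin (0 : ℝ) (Set.Ioi 0),
      ∀ x ∈ {x : ℤ × Fin n | dist (pole T lam x.1 x.2) z₀ < 1},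
        pole T lam x.1 x.2 = z₀ ∨ 2 * ε ≤ dist (pole T lam x.1 x.2) z₀ := by
    rw [Filter.eventually_all_finite hfin]
    intro x _
    by_cases hx : pole T lam x.1 x.2 = z₀
    · exact Filter.Eventually.of_forall fun _ => Or.inl hx
    · have : 0 < dist (pole T lam x.1 x.2) z₀ / 2 := by
        have := dist_pos.2 hx
        positivity
      filter_upwards [mem_nhdsWithin_of_mem_nhds (Iio_mem_nhds this)] with ε hε
      have : ε < dist (pole T lam x.1 x.2) z₀ / 2 := hε
      exact Or.inr (by linarith)
  have h2 : ∀ᶠ ε in nhdsWithin (0 : ℝ) (Set.Ioi 0), ε < 1 / 2 :=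
    mem_nhdsWithin_of_mem_nhds (Iio_mem_nhds (by norm_num))
  obtain ⟨ε, ⟨hε1, hε2⟩, hε⟩ := ((h1.and h2).and self_mem_nhdsWithin).exists
  refine ⟨ε, hε, fun x => ?_⟩
  by_cases hx : dist (pole T lam x.1 x.2) z₀ < 1
  · exact hε1 x hx
  · exact Or.inr (by linarith [not_lt.1 hx])

end Poles

/-! ### Mode expansion of the impulse response -/

section SystemModes

variable {n : ℕ} {T α : ℝ} {S : System n} {lam : Fin n → ℂ}

/-- The coefficient `c_{k-ℓ}ᵀ P_j b_ℓ` of the mode `e^{λ_j^{(ℓ)} r} e^{i k ω₀ t}` in the impulse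
response. -/
def System.modeCoef (T : ℝ) (S : System n) (lam : Fin n → ℂ) (y : ℤ × (ℤ × Fin n)) : ℂ :=
  vecFourierCoef T S.c (y.1 - y.2.1) ⬝ᵥ
    (spectralProj (S.Q.map Complex.ofReal) lam y.2.2 *ᵥ vecFourierCoef T S.b y.2.1)

/-- The two series are multiplied and reindexed by the total frequency `k` in `t`; the leftover
factor `e^{-i ℓ ω₀ r}` is what shifts `λ_j` to `λ_j^{(ℓ)}`. -/
theorem hasSum_mul_fourierCoef_shift (hT : 0 < T) (hα : 1 / 2 < α) {c b : ℝ → ℝ}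
    (hc : IsLip T α c) (hb : IsLip T α b) (t r : ℝ) :
    HasSum (fun y : ℤ × ℤ => fourierCoef T (fun t => (c t : ℂ)) (y.1 - y.2) *
      fourierCoef T (fun t => (b t : ℂ)) y.2 * (Complex.exp (Complex.I * y.1 * freq T * t) *
        Complex.exp (-(Complex.I * y.2 * freq T) * r))) ((c t : ℂ) * b (t - r)) := by
  have hexp : ∀ f : ℝ → ℝ, IsLip T α f → ∀ s : ℝ, HasSum (fun k : ℤ =>
      fourierCoef T (fun t => (f t : ℂ)) k * Complex.exp (Complex.I * k * freq T * s)) (f s) :=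
    fun f hf s => hasSum_fourierCoef hT (Complex.continuous_ofReal.comp hf.continuous)
      (fun t => congrArg Complex.ofReal (hf.periodic t)) (hf.summable_fourierCoef hT hα) s
  have hnorm : ∀ f : ℝ → ℝ, IsLip T α f → ∀ s : ℝ, Summable fun k : ℤ =>
      ‖fourierCoef T (fun t => (f t : ℂ)) k * Complex.exp (Complex.I * k * freq T * s)‖ :=
    fun f hf s => by
      simp only [norm_mul, norm_exp_I_freq, mul_one]
      exact (hf.summable_fourierCoef hT hα).norm
  have h := hasSum_mul_of_summable_norm (hexp c hc t) (hexp b hb (t - r)) (hnorm c hc t)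
    (hnorm b hb (t - r))
  let e : ℤ × ℤ ≃ ℤ × ℤ :=
    { toFun := fun y => (y.1 - y.2, y.2)
      invFun := fun y => (y.1 + y.2, y.2)
      left_inv := fun y => by simp
      right_inv := fun y => by simp }
  rw [← e.hasSum_iff] at h
  refine h.congr_fun fun y => ?_
  have h1 : Complex.exp (Complex.I * y.1 * freq T * t) *
      Complex.exp (-(Complex.I * y.2 * freq T) * r) =
      Complex.exp (Complex.I * (y.1 - y.2 : ℤ) * freq T * t) *
        Complex.exp (Complex.I * y.2 * freq T * (t - r : ℝ)) := by
    rw [← Complex.exp_add, ← Complex.exp_add]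
    congr 1
    push_cast
    ring
  simp only [Function.comp_apply, e, Equiv.coe_fn_mk]
  rw [h1]
  ring

theorem ofReal_dotProduct_exp_mulVec
    (hlam : (S.Q.map Complex.ofReal).charpoly = ∏ j, (Polynomial.X - Polynomial.C (lam j)))
    (hsimple : Function.Injective lam) (c b : Fin n → ℝ) (r : ℝ) :
    ((c ⬝ᵥ (NormedSpace.exp (r • S.Q) *ᵥ b) : ℝ) : ℂ) =
      ∑ j, ∑ i, ∑ i', spectralProj (S.Q.map Complex.ofReal) lam j i i' *
        Complex.exp (lam j * r) * ((c i : ℂ) * b i') := by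
  have h1 : ∀ i i', ((NormedSpace.exp (r • S.Q) i i' : ℝ) : ℂ) =
      ∑ j, Complex.exp (lam j * r) * spectralProj (S.Q.map Complex.ofReal) lam j i i' :=
    fun i i' => by
      have h2 := map_ofReal_exp (r • S.Q)
      have h3 : (r • S.Q).map Complex.ofReal = (r : ℂ) • S.Q.map Complex.ofReal := by
        ext
        simp
      rw [h3, exp_smul_eq_sum hlam hsimple] at h2
      have h4 := congrFun (congrFun h2 i) i'
      rw [Matrix.map_apply] at h4
      rw [h4, Matrix.sum_apply]
      rfl
  simp only [dotProduct, Matrix.mulVec, Complex.ofReal_sum, Complex.ofReal_mul, h1,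
    Finset.sum_mul, Finset.mul_sum]
  rw [Finset.sum_comm_cycle]
  refine Finset.sum_congr rfl fun j _ => ?_
  refine Finset.sum_congr rfl fun i _ => ?_
  refine Finset.sum_congr rfl fun i' _ => ?_
  ring

/-- Expansion of the impulse response into modes. -/
theorem System.hasSum_modes (hT : 0 < T) (hα : 1 / 2 < α)
    (hb : ∀ i, IsLip T α (fun t => S.b t i)) (hc : ∀ i, IsLip T α (fun t => S.c t i))
    (hlam : (S.Q.map Complex.ofReal).charpoly = ∏ j, (Polynomial.X - Polynomial.C (lam j)))
    (hsimple : Function.Injective lam) (t r : ℝ) :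
    HasSum (fun y => S.modeCoef T lam y * mode T (fun x : ℤ × Fin n => pole T lam x.1 x.2) y t r)
      ((S.c t ⬝ᵥ (NormedSpace.exp (r • S.Q) *ᵥ S.b (t - r)) : ℝ) : ℂ) := by
  rw [ofReal_dotProduct_exp_mulVec hlam hsimple, ← (Equiv.prodAssoc ℤ ℤ (Fin n)).hasSum_iff]
  refine hasSum_prod_fintype fun j => ?_
  have h : ∀ i i', HasSum _ _ := fun i i' =>
    (hasSum_mul_fourierCoef_shift hT hα (hc i) (hb i') t r).mul_left
      (spectralProj (S.Q.map Complex.ofReal) lam j i i' * Complex.exp (lam j * r))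
  refine (hasSum_sum fun i (_ : i ∈ Finset.univ) =>
    hasSum_sum fun i' (_ : i' ∈ Finset.univ) => h i i').congr_fun fun y => ?_
  have h1 : mode T (fun x : ℤ × Fin n => pole T lam x.1 x.2) (y.1, (y.2, j)) t r =
      Complex.exp (lam j * r) * (Complex.exp (Complex.I * y.1 * freq T * t) *
        Complex.exp (-(Complex.I * y.2 * freq T) * r)) := by
    rw [mode, pole, sub_mul, sub_eq_add_neg, Complex.exp_add, neg_mul]
    ring
  simp only [Function.comp_apply, Equiv.prodAssoc_apply, h1, System.modeCoef, dotProduct,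
    Matrix.mulVec, vecFourierCoef, Finset.sum_mul, Finset.mul_sum]
  refine Finset.sum_congr rfl fun i _ => Finset.sum_congr rfl fun i' _ => ?_
  ring

theorem System.impulse_sub_of_pos (S : System n) (t : ℝ) {r : ℝ} (hr : 0 < r) :
    S.impulse t (t - r) = S.c t ⬝ᵥ (NormedSpace.exp (r • S.Q) *ᵥ S.b (t - r)) := by
  rw [System.impulse, if_pos (by linarith), sub_sub_cancel]

/-- At `t = r = 0` every mode equals 1, so the expansion there is the series of coefficients itself,
and unconditional convergence in `ℂ` is absolute. -/
theorem System.summable_modeCoef (hT : 0 < T) (hα : 1 / 2 < α)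
    (hb : ∀ i, IsLip T α (fun t => S.b t i)) (hc : ∀ i, IsLip T α (fun t => S.c t i))
    (hlam : (S.Q.map Complex.ofReal).charpoly = ∏ j, (Polynomial.X - Polynomial.C (lam j)))
    (hsimple : Function.Injective lam) : Summable fun y => ‖S.modeCoef T lam y‖ := by
  simpa [mode] using (System.hasSum_modes hT hα hb hc hlam hsimple 0 0).summable.norm

/-- Partial fraction expansion of the transfer functions. -/
theorem System.transfer_eq_tsum (hT : 0 < T)
    (hlam : (S.Q.map Complex.ofReal).charpoly = ∏ j, (Polynomial.X - Polynomial.C (lam j)))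
    (hsimple : Function.Injective lam) (hsum : Summable fun y => ‖S.modeCoef T lam y‖)
    (k : ℤ) {s : ℂ} (hs : ∀ x : ℤ × Fin n, s ≠ pole T lam x.1 x.2) :
    S.transfer T k s =
      ∑' x : ℤ × Fin n, S.modeCoef T lam (k, x) / (s - pole T lam x.1 x.2) := by
  have hinj : Function.Injective fun x : ℤ × Fin n => (k, x) :=
    fun x x' h => (Prod.ext_iff.1 h).2
  obtain ⟨ε, hε, hsep⟩ := exists_pole_separation hT lam s
  have hsummable : Summable fun x : ℤ × Fin n =>
      S.modeCoef T lam (k, x) / (s - pole T lam x.1 x.2) := by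
    refine Summable.of_norm_bounded ((hsum.comp_injective hinj).mul_right (2 * ε)⁻¹) fun x => ?_
    have h1 := (hsep x).resolve_left (hs x).symm
    rw [dist_comm, dist_eq_norm] at h1
    rw [norm_div, div_eq_mul_inv]
    simp only [Function.comp_apply]
    gcongr
  rw [hsummable.tsum_prod, System.transfer]
  refine tsum_congr fun l => ?_
  rw [tsum_fintype, resolvent_eq_sum hlam hsimple fun j hj => hs (l, j) ?_, Matrix.sum_mulVec,
    dotProduct_sum]
  · refine Finset.sum_congr rfl fun j _ => ?_
    rw [Matrix.smul_mulVec, dotProduct_smul, smul_eq_mul, System.modeCoef, pole, div_eq_inv_mul]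
    congr 2
    ring
  · rw [pole, ← hj]
    ring

end SystemModes

/-! ### Transfer functions and the pole-residue formula -/

section PoleResidue

open MeasureTheory Set

variable {n : ℕ} {T α δ : ℝ} {G H S : System n} {lam : Fin n → ℂ}

theorem System.exists_principalPart_transfer (hT : 0 < T)
    (hlam : (S.Q.map Complex.ofReal).charpoly = ∏ j, (Polynomial.X - Polynomial.C (lam j)))
    (hsimple : Function.Injective lam) (hsum : Summable fun y => ‖S.modeCoef T lam y‖)
    (k : ℤ) (z₀ : ℂ) :
    ∃ ε : ℝ, 0 < ε ∧ ∃ R : ℂ → ℂ, DifferentiableOn ℂ R (Metric.ball z₀ ε) ∧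
      ∀ z ∈ Metric.ball z₀ ε, z ≠ z₀ → S.transfer T k z =
        (∑' x : ℤ × Fin n, {x : ℤ × Fin n | pole T lam x.1 x.2 = z₀}.indicator
          (fun x => S.modeCoef T lam (k, x)) x) * (z - z₀)⁻¹ + R z := by
  obtain ⟨ε, hε, hsep⟩ := exists_pole_separation hT lam z₀
  exact ⟨ε, hε, exists_principalPart
    (hsum.comp_injective (i := fun x : ℤ × Fin n => (k, x)) fun x x' h => (Prod.ext_iff.1 h).2)
    hε hsep fun z hz => System.transfer_eq_tsum hT hlam hsimple hsum k hz⟩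

/-- Coinciding `λ_j^{(ℓ)}` merge into one simple fraction with added coefficients, which is why each
point is counted once in general. -/
theorem System.residue_transfer (hT : 0 < T)
    (hlam : (S.Q.map Complex.ofReal).charpoly = ∏ j, (Polynomial.X - Polynomial.C (lam j)))
    (hsimple : Function.Injective lam) (hsum : Summable fun y => ‖S.modeCoef T lam y‖)
    (k : ℤ) (z₀ : ℂ) :
    residue (S.transfer T k) z₀ =
      ∑' x : ℤ × Fin n, {x : ℤ × Fin n | pole T lam x.1 x.2 = z₀}.indicator
        (fun x => S.modeCoef T lam (k, x)) x := by
  obtain ⟨ε, hε, R, hR, hF⟩ :=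
    System.exists_principalPart_transfer hT hlam hsimple hsum k z₀
  exact residue_of_principalPart hε hR hF

theorem System.isMeromorphicLaplace (hT : 0 < T) (hα : 1 / 2 < α)
    (hb : ∀ i, IsLip T α (fun t => S.b t i)) (hc : ∀ i, IsLip T α (fun t => S.c t i))
    (hlam : (S.Q.map Complex.ofReal).charpoly = ∏ j, (Polynomial.X - Polynomial.C (lam j)))
    (hsimple : Function.Injective lam) (hδ : 0 < δ) (hre : ∀ j, (lam j).re ≤ -δ) (k : ℤ) :
    IsMeromorphicLaplace (S.subsystem T k) (S.transfer T k) := by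
  have hsum := System.summable_modeCoef hT hα hb hc hlam hsimple
  have hp : ∀ x : ℤ × Fin n, (pole T lam x.1 x.2).re ≤ -δ := fun x => by
    rw [pole_re]
    exact hre x.2
  refine ⟨fun z₀ => ?_, fun s hs => ?_⟩
  · obtain ⟨ε, hε, R, hR, hF⟩ :=
      System.exists_principalPart_transfer hT hlam hsimple hsum k z₀
    exact meromorphicAt_of_principalPart hε hR hF
  · have hmodes : ∀ r : ℝ, 0 < r → HasSum (fun x : ℤ × Fin n => S.modeCoef T lam (k, x) *
        Complex.exp (pole T lam x.1 x.2 * r)) (S.subsystem T k r) := fun r hr =>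
      hasSum_fourierCoef_modes hT hδ hp hsum hr (fun t => by
        rw [System.impulse_sub_of_pos S t hr]
        exact System.hasSum_modes hT hα hb hc hlam hsimple t r) k
    obtain ⟨h1, h2⟩ := laplace_expSeries hδ (hsum.comp_injective
      (i := fun x : ℤ × Fin n => (k, x)) fun x x' h => (Prod.ext_iff.1 h).2) hp hmodes hs
    refine ⟨h1, h2.tsum_eq.symm.trans ?_⟩
    refine (System.transfer_eq_tsum hT hlam hsimple hsum k fun x hx => ?_).symm
    have := hp x
    rw [← hx] at this
    linarith

theorem System.norm_impulse_le (hT : 0 < T) (hα : 1 / 2 < α)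
    (hb : ∀ i, IsLip T α (fun t => S.b t i)) (hc : ∀ i, IsLip T α (fun t => S.c t i))
    (hlam : (S.Q.map Complex.ofReal).charpoly = ∏ j, (Polynomial.X - Polynomial.C (lam j)))
    (hsimple : Function.Injective lam) (hre : ∀ j, (lam j).re ≤ -δ) (t : ℝ) {r : ℝ} (hr : 0 < r) :
    ‖(S.impulse t (t - r) : ℂ)‖ ≤ (∑' y, ‖S.modeCoef T lam y‖) * Real.exp (-δ * r) := by
  have hsum := System.summable_modeCoef hT hα hb hc hlam hsimple
  rw [System.impulse_sub_of_pos S t hr,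
    ← (System.hasSum_modes hT hα hb hc hlam hsimple t r).tsum_eq]
  refine tsum_of_norm_bounded (hsum.hasSum.mul_right _) fun y => ?_
  rw [norm_mul]
  refine mul_le_mul_of_nonneg_left (norm_mode_le (fun x => ?_) y t hr.le) (norm_nonneg _)
  rw [pole_re]
  exact hre x.2

open scoped Matrix.Norms.Operator in
-- For `r > 0` the causal cutoff is inactive. This supplies the measurability behind absolute
-- integrability.
theorem System.continuousOn_impulse (hb : ∀ i, IsLip T α (fun t => S.b t i))
    (hc : ∀ i, IsLip T α (fun t => S.c t i)) :
    ContinuousOn (fun x : ℝ × ℝ => S.impulse x.1 (x.1 - x.2)) (Icc 0 T ×ˢ Ioi 0) := by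
  have hb' : Continuous S.b := continuous_pi fun i => (hb i).continuous
  have hc' : Continuous S.c := continuous_pi fun i => (hc i).continuous
  have hexp : Continuous fun x : ℝ × ℝ => NormedSpace.exp (x.2 • S.Q) :=
    NormedSpace.exp_continuous.comp (by fun_prop)
  have h : Continuous fun x : ℝ × ℝ =>
      S.c x.1 ⬝ᵥ (NormedSpace.exp (x.2 • S.Q) *ᵥ S.b (x.1 - x.2)) :=
    (hc'.comp continuous_fst).dotProduct (hexp.matrix_mulVec (hb'.comp (by fun_prop)))
  exact h.continuousOn.congr fun x hx => System.impulse_sub_of_pos S x.1 hx.2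

theorem h2Integrable (hT : 0 < T) (hα : 1 / 2 < α) (hQ : H.Q = G.Q)
    (hGb : ∀ i, IsLip T α (fun t => G.b t i)) (hGc : ∀ i, IsLip T α (fun t => G.c t i))
    (hHb : ∀ i, IsLip T α (fun t => H.b t i)) (hHc : ∀ i, IsLip T α (fun t => H.c t i))
    (hlam : (G.Q.map Complex.ofReal).charpoly = ∏ j, (Polynomial.X - Polynomial.C (lam j)))
    (hsimple : Function.Injective lam) (hδ : 0 < δ) (hre : ∀ j, (lam j).re ≤ -δ) :
    H2Integrable T G H := by
  have hmeas : AEStronglyMeasurable (h2Integrand G H)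
      (volume.restrict (Icc 0 T ×ˢ Ioi 0)) := by
    refine ContinuousOn.aestronglyMeasurable ?_ (measurableSet_Icc.prod measurableSet_Ioi)
    exact (Complex.continuous_conj.comp_continuousOn (Complex.continuous_ofReal.comp_continuousOn
      (System.continuousOn_impulse hGb hGc))).mul (Complex.continuous_ofReal.comp_continuousOn
        (System.continuousOn_impulse hHb hHc))
  have hbound : IntegrableOn (fun x : ℝ × ℝ => (∑' y, ‖G.modeCoef T lam y‖) *
      (∑' y, ‖H.modeCoef T lam y‖) * Real.exp (-(2 * δ) * x.2)) (Icc 0 T ×ˢ Ioi 0) := by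
    rw [IntegrableOn, Measure.volume_eq_prod, ← Measure.prod_restrict]
    refine Integrable.mul_prod (f := fun _ : ℝ => (∑' y, ‖G.modeCoef T lam y‖) *
      (∑' y, ‖H.modeCoef T lam y‖)) (g := fun r : ℝ => Real.exp (-(2 * δ) * r)) ?_ ?_
    · exact integrable_const _
    · exact integrableOn_exp_mul_Ioi (by linarith) 0
  refine Integrable.mono' hbound hmeas ?_
  filter_upwards [ae_restrict_mem (measurableSet_Icc.prod measurableSet_Ioi)] with x hx
  have h1 := System.norm_impulse_le hT hα hGb hGc hlam hsimple hre x.1 hx.2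
  have h2 := System.norm_impulse_le hT hα hHb hHc (by rwa [hQ]) hsimple hre x.1 hx.2
  rw [h2Integrand, norm_mul, RCLike.norm_conj]
  refine (mul_le_mul h1 h2 (norm_nonneg _) ((norm_nonneg _).trans h1)).trans_eq ?_
  rw [mul_mul_mul_comm, ← Real.exp_add]
  congr 2
  ring

/-- The pole-residue formula, every point `λ_j^{(ℓ)}` being counted once. -/
theorem hasSum_poleResidueTerm (hT : 0 < T) (hα : 1 / 2 < α) (hQ : H.Q = G.Q)
    (hGb : ∀ i, IsLip T α (fun t => G.b t i)) (hGc : ∀ i, IsLip T α (fun t => G.c t i))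
    (hHb : ∀ i, IsLip T α (fun t => H.b t i)) (hHc : ∀ i, IsLip T α (fun t => H.c t i))
    (hlam : (G.Q.map Complex.ofReal).charpoly = ∏ j, (Polynomial.X - Polynomial.C (lam j)))
    (hsimple : Function.Injective lam) (hδ : 0 < δ) (hre : ∀ j, (lam j).re ≤ -δ) :
    HasSum (fun x : ℤ × poleSet T lam => poleResidueTerm T G H x.1 x.2) (h2Inner T G H) := by
  have hlamH : (H.Q.map Complex.ofReal).charpoly =
      ∏ j, (Polynomial.X - Polynomial.C (lam j)) := by rwa [hQ]
  have hGsum := System.summable_modeCoef hT hα hGb hGc hlam hsimple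
  have hHsum := System.summable_modeCoef hT hα hHb hHc hlamH hsimple
  have hp : ∀ x : ℤ × Fin n, (pole T lam x.1 x.2).re ≤ -δ := fun x => by
    rw [pole_re]
    exact hre x.2
  have hmodes : ∀ S : System n, (∀ i, IsLip T α (fun t => S.b t i)) →
      (∀ i, IsLip T α (fun t => S.c t i)) →
      (S.Q.map Complex.ofReal).charpoly = ∏ j, (Polynomial.X - Polynomial.C (lam j)) →
      ∀ t r : ℝ, 0 < r → HasSum (fun y => S.modeCoef T lam y *
        mode T (fun x : ℤ × Fin n => pole T lam x.1 x.2) y t r) (S.impulse t (t - r) : ℂ) :=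
    fun S hb hc hl t r hr => by
      rw [System.impulse_sub_of_pos S t hr]
      exact System.hasSum_modes hT hα hb hc hl hsimple t r
  have hpair := hasSum_pairing hT hδ hp hGsum hHsum (hmodes G hGb hGc hlam)
    (hmodes H hHb hHc hlamH)
  -- Grouping by `k` and by the point of the plane, rather than by its label `(ℓ, j)`, assembles the
  -- residue of `ĥ_k`.
  have hfib := hasSum_fiberwise hpair
    fun y : ℤ × (ℤ × Fin n) => (y.1, (⟨pole T lam y.2.1 y.2.2, y.2.1, y.2.2, rfl⟩ : poleSet T lam))
  refine hfib.congr_fun fun z => ?_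
  obtain ⟨k, q, hq⟩ := z
  have hqre : q.re ≤ -δ := by
    obtain ⟨l, j, rfl⟩ := hq
    exact hp (l, j)
  have hconj : conjFun (G.transfer T k) (-q) =
      conj (∑' x : ℤ × Fin n, G.modeCoef T lam (k, x) / (-conj q - pole T lam x.1 x.2)) := by
    -- The partial fractions may be used at `-conj q`: it lies in the right half-plane, away from
    -- all poles.
    rw [conjFun, System.transfer_eq_tsum hT hlam hsimple hGsum, map_neg]
    intro x hx
    have h1 := hp x
    rw [← hx, map_neg, Complex.neg_re, Complex.conj_re] at h1
    linarith
  simp only [poleResidueTerm]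
  rw [hconj, System.residue_transfer hT hlamH hsimple hHsum, ← tsum_mul_left]
  have hinj : Function.Injective fun x : ℤ × Fin n => (k, x) :=
    fun x x' h => (Prod.ext_iff.1 h).2
  -- The fibre sum runs over all frequencies but is supported on the single `k`.
  refine Eq.trans ?_ (hinj.tsum_eq ?_)
  · refine tsum_congr fun x => ?_
    by_cases hx : pole T lam x.1 x.2 = q
    · simp [Set.indicator, hx]
    · have : (⟨pole T lam x.1 x.2, x.1, x.2, rfl⟩ : poleSet T lam) ≠ ⟨q, hq⟩ :=
        fun h => hx (congrArg Subtype.val h)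
      simp [Set.indicator, hx, this]
  · intro y hy
    have hy1 := Set.mem_of_indicator_ne_zero hy
    exact ⟨y.2, Prod.ext (Prod.ext_iff.1 hy1).1.symm rfl⟩

theorem h2Norm_sq (hT : 0 < T) (G : System n) :
    ((h2Norm T G ^ 2 : ℝ) : ℂ) = h2Inner T G G := by
  have hnn : 0 ≤ 1 / T * ∫ t in (0 : ℝ)..T, ∫ r in Ioi (0 : ℝ), |G.impulse t (t - r)| ^ 2 :=
    mul_nonneg (by positivity) (intervalIntegral.integral_nonneg hT.le fun t _ =>
      integral_nonneg fun r => by positivity)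
  rw [h2Norm, Real.sq_sqrt hnn, h2Inner]
  push_cast
  rw [← intervalIntegral.integral_ofReal]
  congr 1
  refine intervalIntegral.integral_congr fun t _ => ?_
  rw [← integral_complex_ofReal]
  refine integral_congr_ae (Filter.Eventually.of_forall fun r => ?_)
  simp only [h2Integrand, Complex.conj_ofReal, sq_abs]
  push_cast
  ring

/-- Reindexing of the series over the set of poles when all the `λ_j^{(ℓ)}` are distinct. -/
theorem summable_and_tsum_of_pole_injective {f : ℤ → ℂ → ℂ} {I : ℂ}
    (hf : HasSum (fun x : ℤ × poleSet T lam => f x.1 x.2) I)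
    (hinj : ∀ l l' : ℤ, ∀ j j' : Fin n, pole T lam l j = pole T lam l' j' → l = l' ∧ j = j') :
    Summable (fun x : ℤ × ℤ × Fin n => f x.1 (pole T lam x.2.1 x.2.2)) ∧
      I = ∑' k : ℤ, ∑' l : ℤ, ∑ j, f k (pole T lam l j) := by
  let e : ℤ × Fin n ≃ poleSet T lam := Equiv.ofBijective
    (fun x => ⟨pole T lam x.1 x.2, x.1, x.2, rfl⟩)
    ⟨fun x x' h => Prod.ext_iff.2 (hinj _ _ _ _ (congrArg Subtype.val h)),
      fun ⟨_, l, j, h⟩ => ⟨(l, j), Subtype.ext h.symm⟩⟩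
  have h1 : HasSum (fun x : ℤ × ℤ × Fin n => f x.1 (pole T lam x.2.1 x.2.2)) I :=
    ((Equiv.prodCongr (Equiv.refl ℤ) e).hasSum_iff).2 hf
  refine ⟨h1.summable, ?_⟩
  rw [← h1.tsum_eq, h1.summable.tsum_prod]
  refine tsum_congr fun k => ?_
  rw [(h1.summable.prod_factor k).tsum_prod]
  exact tsum_congr fun l => tsum_fintype _

end PoleResidue

end LTP

end

theorem theorem3p4 {n : ℕ} (T α : ℝ) (hT : 0 < T) (hα : 1 / 2 < α)
    (G H : LTP.System n) (hQ : H.Q = G.Q)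
    (hGb : ∀ i, LTP.IsLip T α (fun t => G.b t i)) (hGc : ∀ i, LTP.IsLip T α (fun t => G.c t i))
    (hHb : ∀ i, LTP.IsLip T α (fun t => H.b t i)) (hHc : ∀ i, LTP.IsLip T α (fun t => H.c t i))
    (lam : Fin n → ℂ)
    -- `lam` lists the eigenvalues of the common state matrix, which are simple
    (hlam : (G.Q.map Complex.ofReal).charpoly = ∏ j, (Polynomial.X - Polynomial.C (lam j)))
    (hsimple : Function.Injective lam)
    (hstable : ∀ j, (lam j).re < 0)
    (hfreq : ∀ j, |(lam j).im| < LTP.freq T) :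
    -- the series `ĝ_k`, `ĥ_k` are the Laplace transforms of the subsystems, continued
    -- meromorphically to the plane
    (∀ k : ℤ, LTP.IsMeromorphicLaplace (G.subsystem T k) (G.transfer T k) ∧
      LTP.IsMeromorphicLaplace (H.subsystem T k) (H.transfer T k)) ∧
    -- inner product and norm are given by convergent integrals
    LTP.H2Integrable T G H ∧ LTP.H2Integrable T G G ∧
    -- pole-residue formulas, every point `λ_j^{(ℓ)}` being counted once
    (Summable (fun x : ℤ × LTP.poleSet T lam => LTP.poleResidueTerm T G H x.1 x.2) ∧
      LTP.h2Inner T G H = ∑' k : ℤ, ∑' p : LTP.poleSet T lam, LTP.poleResidueTerm T G H k p) ∧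
    (Summable (fun x : ℤ × LTP.poleSet T lam => LTP.poleResidueTerm T G G x.1 x.2) ∧
      ((LTP.h2Norm T G ^ 2 : ℝ) : ℂ) =
        ∑' k : ℤ, ∑' p : LTP.poleSet T lam, LTP.poleResidueTerm T G G k p) ∧
    -- the triple series, when the `λ_j^{(ℓ)}` are pairwise distinct
    ((∀ l l' : ℤ, ∀ j j' : Fin n,
        LTP.pole T lam l j = LTP.pole T lam l' j' → l = l' ∧ j = j') →
      (Summable (fun x : ℤ × ℤ × Fin n =>
          LTP.poleResidueTerm T G H x.1 (LTP.pole T lam x.2.1 x.2.2)) ∧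
        LTP.h2Inner T G H =
          ∑' k : ℤ, ∑' l : ℤ, ∑ j, LTP.poleResidueTerm T G H k (LTP.pole T lam l j)) ∧
      (Summable (fun x : ℤ × ℤ × Fin n =>
          LTP.poleResidueTerm T G G x.1 (LTP.pole T lam x.2.1 x.2.2)) ∧
        ((LTP.h2Norm T G ^ 2 : ℝ) : ℂ) =
          ∑' k : ℤ, ∑' l : ℤ, ∑ j, LTP.poleResidueTerm T G G k (LTP.pole T lam l j))) := by
  obtain ⟨δ, hδ, hre⟩ := LTP.exists_decay_rate hstable
  have hGH := LTP.hasSum_poleResidueTerm hT hα hQ hGb hGc hHb hHc hlam hsimple hδ hre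
  have hGG := LTP.hasSum_poleResidueTerm hT hα rfl hGb hGc hGb hGc hlam hsimple hδ hre
  rw [← LTP.h2Norm_sq hT] at hGG
  refine ⟨fun k => ⟨?_, ?_⟩, ?_, ?_, ⟨hGH.summable, ?_⟩, ⟨hGG.summable, ?_⟩, fun hinj => ⟨?_, ?_⟩⟩
  · exact LTP.System.isMeromorphicLaplace hT hα hGb hGc hlam hsimple hδ hre k
  · exact LTP.System.isMeromorphicLaplace hT hα hHb hHc (by rwa [hQ]) hsimple hδ hre k
  · exact LTP.h2Integrable hT hα hQ hGb hGc hHb hHc hlam hsimple hδ hre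
  · exact LTP.h2Integrable hT hα rfl hGb hGc hGb hGc hlam hsimple hδ hre
  · rw [← hGH.tsum_eq, hGH.summable.tsum_prod]
  · rw [← hGG.tsum_eq, hGG.summable.tsum_prod]
  · exact LTP.summable_and_tsum_of_pole_injective (f := LTP.poleResidueTerm T G H) hGH hinj
  · exact LTP.summable_and_tsum_of_pole_injective (f := LTP.poleResidueTerm T G G) hGG hinj
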